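/- **Setting.** Let $d\ge 1$, $\mathcal H=L^2(\mathbf R^d)$ (complex valued), and let $H_0=-\overline{\Delta}=\mathcal F^{-1}p\mathcal F$ be the closed operator with symbol $p(\xi)=|\xi|^2$ and domain $\{\phi\in\mathcal H: p\,\mathcal F\phi\in\mathcal H\}$. Fix $a>0$ and put $R_0=(aI+H_0)^{-1}$. For a measurable $V:\mathbf R^d\to\mathbf C$ let $\Vert V\Vert_{R_0}=\sup\{\Vert V(R_0\phi)\Vert:\Vert\phi\Vert\le 1\}\in[0,\infty]$, let $\tilde{\mathcal V}_{R_0}$ be the space of those $V$ with $\Vert V\Vert_{R_0}<\infty$, and let $\mathcal V_{R_0}$ be the closure of $L^\infty(\mathbf R^d)$ in $\tilde{\mathcal V}_{R_0}$. For measurable $S\subseteq\mathbf R^d$ let $P_S$ be multiplication by the indicator function of $S$, and let $P_{b,r}=P_{B(b,r)}$. For $m=0,1,2,\dots$ let $\mathcal A_m$ be the set of bounded operators $A$ on $\mathcal H$ such that $P_{b,r}AP_{b',s}\neq0$ implies $|b-b'|\le r+s+m$ (for all $b,b'\in\mathbf R^d$ and $r,s>0$). The standard $C^*$-algebra $\mathcal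 A$ is the norm closure of $\bigcup_m\mathcal A_m$. For $S\subseteq\mathbf R^d$ put $S(r)=\{x:\mathrm{dist}(x,S)<r\}$, and let $\mathcal J_S$ be the norm closure of $\bigcup_{n\ge1}\{A\in\mathcal A: A=P_{S(n)}AP_{S(n)}\}$, a closed two-sided ideal of $\mathcal A$, with quotient map $\pi_S:\mathcal A\to\mathcal A/\mathcal J_S$. A closed operator $A$ on $\mathcal H$ is *affiliated to* $\mathcal A$ if $R(z,A)=(zI-A)^{-1}\in\mathcal A$ for some (equivalently, every) $z\notin\sigma(A)$. For such $A$, $\sigma_S(A)$ denotes the spectrum of the pseudo-resolvent $z\mapsto\pi_S(R(z,A))$ in $\mathcal A/\mathcal J_S$, i.e. the set of $z\in\mathbf C$ for which $1+(z-\alpha)\pi_S(R(\alpha,A))$ is not invertible; this set does not depend on the choice of $\alpha\notin\sigma(A)$. The essential spectrum $\sigma_{\rm ess}(A)$ is defined in the same way from the image of the resolvent in the Calkin algebra $\mathcal L(\mathcal H)/\mathcal K(\mathcal H)$. **Theorem.** Let $W,X:\mathbf R^d\to\mathbf C$ and $V=W+X$. Suppose that $V,W\in\mathcal V_{R_0}$,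 $\Vert V\Vert_{R_0}<1$ and $\Vert W\Vert_{R_0}<1$; that $W$ is periodic in the $x_1$ direction (with some period $k>0$); and that $X$ has support in $S(c)=\{x:|x_1|<c+1\}$ for some $c\ge1$, where $S=\{x\in\mathbf R^d:|x_1|<1\}$. Let $H=H_0+V$. Then $H_0+W$ and $H$ are closed and affiliated to $\mathcal A$, and $$\sigma(H_0+W)=\sigma_{\rm ess}(H_0+W)=\sigma_S(H_0+W)=\sigma_S(H)\subseteq\sigma_{\rm ess}(H)\subseteq\sigma(H).$$ -/

import Mathlib

namespace DaviesSpectra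

open MeasureTheory Metric Set
open scoped ENNReal

/-! ### Unbounded operators: resolvents and spectra -/

section Unbounded

variable {H : Type*} [NormedAddCommGroup H] [NormedSpace ℂ H]

/-- `R` is the bounded two-sided inverse of `z - A : Dom A → H`. -/
def IsResolventAt (A : H →ₗ.[ℂ] H) (z : ℂ) (R : H →L[ℂ] H) : Prop :=
  (∀ φ : H, ∃ h : R φ ∈ A.domain, z • R φ - A ⟨R φ, h⟩ = φ) ∧
    ∀ ψ : A.domain, R (z • (ψ : H) - A ψ) = ψ

/-- The resolvent set of an unbounded operator. -/
def resolventSet (A : H →ₗ.[ℂ] H) : Set ℂ := {z | ∃ R, IsResolventAt A z R}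

/-- The spectrum of an unbounded operator. -/
def spec (A : H →ₗ.[ℂ] H) : Set ℂ := (resolventSet A)ᶜ

theorem IsResolventAt.unique {A : H →ₗ.[ℂ] H} {z : ℂ} {R R' : H →L[ℂ] H}
    (h : IsResolventAt A z R) (h' : IsResolventAt A z R') : R = R' := by
  ext φ
  obtain ⟨hm, e⟩ := h.1 φ
  have := h'.2 ⟨R φ, hm⟩
  rw [e] at this
  exact this.symm

open Classical in
/-- The resolvent `R(z, A) = (z - A)⁻¹` for `z` in the resolvent set (and `0` elsewhere). -/
noncomputable def resolvent (A : H →ₗ.[ℂ] H) (z : ℂ) : H →L[ℂ] H :=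
  if h : z ∈ resolventSet A then h.choose else 0

theorem isResolventAt_resolvent {A : H →ₗ.[ℂ] H} {z : ℂ} (h : z ∈ resolventSet A) :
    IsResolventAt A z (resolvent A z) := by
  rw [resolvent, dif_pos h]
  exact h.choose_spec

/-- The spectrum of a pseudo-resolvent `r : U → B` in a complex algebra `B`: the complement of the
domain `{z | 1 + (z - α) r_α is invertible}` of its maximal extension. -/
def pseudoSpectrum {B : Type*} [Ring B] [Algebra ℂ B] (U : Set ℂ) (r : U → B) : Set ℂ :=
  {z | ∀ α : U, ¬ IsUnit (1 + (z - (α : ℂ)) • r α)}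

/-- The ideal of compact operators in the algebra of bounded operators. -/
def compactIdeal (H : Type*) [NormedAddCommGroup H] [NormedSpace ℂ H] : Ideal (H →L[ℂ] H) where
  carrier := {T | IsCompactOperator T}
  add_mem' := fun ha hb => IsCompactOperator.add ha hb
  zero_mem' := isCompactOperator_zero
  smul_mem' := fun c _ hx => IsCompactOperator.clm_comp hx c

instance : (compactIdeal H).IsTwoSided :=
  ⟨fun {_} b ha => IsCompactOperator.comp_clm ha b⟩

/-- The essential spectrum, defined through the image of the resolvent family in the Calkin
algebra. -/
def essSpec (A : H →ₗ.[ℂ] H) : Set ℂ :=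
  pseudoSpectrum (resolventSet A) fun α => Ideal.Quotient.mk (compactIdeal H) (resolvent A α)

end Unbounded

/-! ### Multiplication operators on `L²(ℝᵈ)` -/

/-- `ℝᵈ` with its Euclidean norm. -/
abbrev Eu (d : ℕ) : Type := EuclideanSpace ℝ (Fin d)

/-- The complex Hilbert space `L²(ℝᵈ)`. -/
abbrev L2 (d : ℕ) : Type := Lp ℂ 2 (volume : Measure (Eu d))

variable {d : ℕ}

theorem toLp_add_of_ae {f g h : Eu d → ℂ} (hf : MemLp f 2 (volume : Measure (Eu d)))
    (hg : MemLp g 2 volume) (hh : MemLp h 2 volume) (e : f =ᵐ[volume] g + h) :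
    hf.toLp f = hg.toLp g + hh.toLp h := by
  apply Lp.ext
  filter_upwards [hf.coeFn_toLp, hg.coeFn_toLp, hh.coeFn_toLp, e,
    Lp.coeFn_add (hg.toLp g) (hh.toLp h)] with x h1 h2 h3 h4 h5
  rw [h5, Pi.add_apply, h1, h2, h3, h4, Pi.add_apply]

theorem toLp_smul_of_ae {f g : Eu d → ℂ} (c : ℂ) (hf : MemLp f 2 (volume : Measure (Eu d)))
    (hg : MemLp g 2 volume) (e : f =ᵐ[volume] c • g) : hf.toLp f = c • hg.toLp g := by
  apply Lp.ext
  filter_upwards [hf.coeFn_toLp, hg.coeFn_toLp, e, Lp.coeFn_smul c (hg.toLp g)] with x h1 h2 h3 h4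
  rw [h4, Pi.smul_apply, h1, h2, h3, Pi.smul_apply]

theorem mul_add_ae (V : Eu d → ℂ) (φ ψ : L2 d) :
    (fun x => V x * (φ + ψ) x) =ᵐ[volume] (fun x => V x * φ x) + fun x => V x * ψ x := by
  filter_upwards [Lp.coeFn_add φ ψ] with x hx
  rw [hx, Pi.add_apply, Pi.add_apply, mul_add]

theorem mul_smul_ae (V : Eu d → ℂ) (c : ℂ) (φ : L2 d) :
    (fun x => V x * (c • φ) x) =ᵐ[volume] c • fun x => V x * φ x := by
  filter_upwards [Lp.coeFn_smul c φ] with x hx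
  rw [hx, Pi.smul_apply, Pi.smul_apply, smul_eq_mul, smul_eq_mul, mul_left_comm]

theorem mul_zero_ae (V : Eu d → ℂ) :
    (fun x => V x * (0 : L2 d) x) =ᵐ[volume] (0 : Eu d → ℂ) := by
  filter_upwards [Lp.coeFn_zero ℂ 2 (volume : Measure (Eu d))] with x hx
  rw [hx, Pi.zero_apply, mul_zero]

theorem indicator_add_ae (S : Set (Eu d)) (φ ψ : L2 d) :
    S.indicator (φ + ψ : L2 d) =ᵐ[volume] S.indicator φ + S.indicator ψ := by
  filter_upwards [Lp.coeFn_add φ ψ] with x hx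
  by_cases h : x ∈ S
  · rw [Pi.add_apply, indicator_of_mem h, indicator_of_mem h, indicator_of_mem h, hx, Pi.add_apply]
  · rw [Pi.add_apply, indicator_of_notMem h, indicator_of_notMem h, indicator_of_notMem h, add_zero]

theorem indicator_smul_ae (S : Set (Eu d)) (c : ℂ) (φ : L2 d) :
    S.indicator (c • φ : L2 d) =ᵐ[volume] c • S.indicator φ := by
  filter_upwards [Lp.coeFn_smul c φ] with x hx
  by_cases h : x ∈ S
  · rw [Pi.smul_apply, indicator_of_mem h, indicator_of_mem h, hx, Pi.smul_apply]
  · rw [Pi.smul_apply, indicator_of_notMem h, indicator_of_notMem h, smul_zero]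

/-- The maximal domain `{φ ∈ L² | V φ ∈ L²}` of multiplication by `V`. -/
noncomputable def mulDomain (V : Eu d → ℂ) : Submodule ℂ (L2 d) where
  carrier := {φ | MemLp (fun x => V x * φ x) 2 volume}
  zero_mem' := (memLp_congr_ae (mul_zero_ae V)).2 MemLp.zero
  add_mem' := fun {φ ψ} hφ hψ => (memLp_congr_ae (mul_add_ae V φ ψ)).2 (MemLp.add hφ hψ)
  smul_mem' := fun c φ hφ => (memLp_congr_ae (mul_smul_ae V c φ)).2 (MemLp.const_smul hφ c)

/-- The multiplication operator by `V`, on its maximal domain. -/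
noncomputable def mulOp (V : Eu d → ℂ) : L2 d →ₗ.[ℂ] L2 d where
  domain := mulDomain V
  toFun :=
    { toFun := fun φ => MemLp.toLp (fun x => V x * (φ : L2 d) x) φ.2
      map_add' := fun φ ψ => toLp_add_of_ae _ _ _ (mul_add_ae V φ ψ)
      map_smul' := fun c φ => toLp_smul_of_ae c _ _ (mul_smul_ae V c φ) }

/-- Multiplication by the indicator function of `S`, as a linear map. -/
noncomputable def projLin (S : Set (Eu d)) (hS : MeasurableSet S) : L2 d →ₗ[ℂ] L2 d where
  toFun := fun φ => MemLp.toLp (S.indicator φ) ((Lp.memLp φ).indicator hS)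
  map_add' := fun φ ψ => toLp_add_of_ae _ _ _ (indicator_add_ae S φ ψ)
  map_smul' := fun c φ => toLp_smul_of_ae c _ _ (indicator_smul_ae S c φ)

theorem projLin_coeFn (S : Set (Eu d)) (hS : MeasurableSet S) (φ : L2 d) :
    (projLin S hS φ : Eu d → ℂ) =ᵐ[volume] S.indicator φ := by
  have h : projLin S hS φ = MemLp.toLp (S.indicator φ) ((Lp.memLp φ).indicator hS) := rfl
  rw [h]
  exact MemLp.coeFn_toLp _

theorem norm_projLin_le (S : Set (Eu d)) (hS : MeasurableSet S) (φ : L2 d) :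
    ‖projLin S hS φ‖ ≤ 1 * ‖φ‖ := by
  rw [one_mul]
  refine Lp.norm_le_norm_of_ae_le ?_
  filter_upwards [projLin_coeFn S hS φ] with x hx
  rw [hx]
  exact norm_indicator_le_norm_self _ _

/-- The projection `P_S`: multiplication by the indicator function of `S`. -/
noncomputable def proj (S : Set (Eu d)) (hS : MeasurableSet S) : L2 d →L[ℂ] L2 d :=
  (projLin S hS).mkContinuous 1 (norm_projLin_le S hS)

theorem proj_coeFn (S : Set (Eu d)) (hS : MeasurableSet S) (φ : L2 d) :
    (proj S hS φ : Eu d → ℂ) =ᵐ[volume] S.indicator φ :=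
  projLin_coeFn S hS φ

theorem proj_mul (S T : Set (Eu d)) (hS : MeasurableSet S) (hT : MeasurableSet T) :
    proj S hS * proj T hT = proj (S ∩ T) (hS.inter hT) := by
  ext1 φ
  apply Lp.ext
  rw [mul_apply_eq_comp]
  filter_upwards [proj_coeFn S hS (proj T hT φ), proj_coeFn T hT φ,
    proj_coeFn (S ∩ T) (hS.inter hT) φ] with x h1 h2 h3
  rw [h1, h3]
  by_cases hx : x ∈ S <;> by_cases hy : x ∈ T <;> simp [hx, hy, h2]

theorem proj_comm (S T : Set (Eu d)) (hS : MeasurableSet S) (hT : MeasurableSet T) :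
    proj S hS * proj T hT = proj T hT * proj S hS := by
  rw [proj_mul, proj_mul]
  congr 1
  exact inter_comm _ _

theorem proj_empty : proj (∅ : Set (Eu d)) MeasurableSet.empty = 0 := by
  ext1 φ
  apply Lp.ext
  filter_upwards [proj_coeFn ∅ MeasurableSet.empty φ, Lp.coeFn_zero ℂ 2 (volume : Measure (Eu d))]
    with x h1 h2
  rw [h1, indicator_empty]
  exact h2.symm

theorem proj_mul_eq_zero (S T : Set (Eu d)) (hS : MeasurableSet S) (hT : MeasurableSet T)
    (h : S ∩ T = ∅) : proj S hS * proj T hT = 0 := by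
  rw [proj_mul, ← proj_empty]
  congr 1

theorem proj_add_compl (S : Set (Eu d)) (hS : MeasurableSet S) :
    proj S hS + proj Sᶜ hS.compl = 1 := by
  ext1 φ
  apply Lp.ext
  rw [add_apply]
  filter_upwards [proj_coeFn S hS φ, proj_coeFn Sᶜ hS.compl φ,
    Lp.coeFn_add (proj S hS φ) (proj Sᶜ hS.compl φ)] with x h1 h2 h3
  rw [h3, Pi.add_apply, h1, h2]
  by_cases hx : x ∈ S <;> simp [hx]

theorem proj_union (S T : Set (Eu d)) (hS : MeasurableSet S) (hT : MeasurableSet T) :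
    proj (S ∪ T) (hS.union hT) = proj S hS + proj T hT * proj Sᶜ hS.compl := by
  rw [proj_mul]
  ext1 φ
  apply Lp.ext
  rw [add_apply]
  filter_upwards [proj_coeFn S hS φ, proj_coeFn (T ∩ Sᶜ) (hT.inter hS.compl) φ,
    proj_coeFn (S ∪ T) (hS.union hT) φ,
    Lp.coeFn_add (proj S hS φ) (proj (T ∩ Sᶜ) (hT.inter hS.compl) φ)] with x h1 h2 h3 h4
  rw [h4, Pi.add_apply, h1, h2, h3]
  by_cases hx : x ∈ S <;> by_cases hy : x ∈ T <;> simp [hx, hy]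

theorem star_proj (S : Set (Eu d)) (hS : MeasurableSet S) : star (proj S hS) = proj S hS := by
  rw [ContinuousLinearMap.star_eq_adjoint, eq_comm, ContinuousLinearMap.eq_adjoint_iff]
  intro φ ψ
  rw [L2.inner_def, L2.inner_def]
  apply integral_congr_ae
  filter_upwards [proj_coeFn S hS φ, proj_coeFn S hS ψ] with x h1 h2
  rw [h1, h2]
  by_cases hx : x ∈ S <;> simp [hx]

/-- If `A B ≠ 0` then some ball of radius `ε` meets the right support of `A` and the left support
of `B`. -/
theorem exists_ball_of_mul_ne_zero {A B : L2 d →L[ℂ] L2 d} (h : A * B ≠ 0) {ε : ℝ} (hε : 0 < ε) :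
    ∃ c : Eu d, A * proj (ball c ε) measurableSet_ball ≠ 0 ∧
      proj (ball c ε) measurableSet_ball * B ≠ 0 := by
  by_contra! hcon
  apply h
  let u := TopologicalSpace.denseSeq (Eu d)
  let F : ℕ → Set (Eu d) := fun N => ⋃ n ∈ Finset.range N, ball (u n) ε
  have hF : ∀ N, MeasurableSet (F N) := fun N =>
    Finset.measurableSet_biUnion _ fun _ _ => measurableSet_ball
  have hz : ∀ N, A * proj (F N) (hF N) * B = 0 := by
    intro N
    induction N with
    | zero =>
      have : proj (F 0) (hF 0) = 0 := by
        rw [← proj_empty]; congr 1; simp [F]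
      simp [this]
    | succ N ih =>
      have e : proj (F (N + 1)) (hF (N + 1)) = proj (F N) (hF N) +
          proj (ball (u N) ε) measurableSet_ball * proj (F N)ᶜ (hF N).compl := by
        rw [← proj_union]; congr 1
        simp only [F, Finset.range_add_one, Finset.set_biUnion_insert]
        exact union_comm _ _
      rw [e, mul_add, add_mul, ih, zero_add]
      by_cases hA : A * proj (ball (u N) ε) measurableSet_ball = 0
      · rw [← mul_assoc, hA, zero_mul, zero_mul]
      · rw [proj_comm, mul_assoc, mul_assoc, hcon _ hA, mul_zero, mul_zero]
  have hcov : ⋃ N, F N = univ := by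
    rw [eq_univ_iff_forall]
    intro x
    obtain ⟨n, hn⟩ := (TopologicalSpace.denseRange_denseSeq (Eu d)).exists_dist_lt x hε
    refine mem_iUnion.2 ⟨n + 1, ?_⟩
    simp only [F, mem_iUnion]
    exact ⟨n, by simp, hn⟩
  have hmono : Monotone F := by
    intro M N hMN
    exact biUnion_subset_biUnion_left fun n hn => Finset.mem_coe.2
      (Finset.range_mono hMN (Finset.mem_coe.1 hn))
  ext1 φ
  rw [mul_apply_eq_comp, zero_apply]
  refine ext_inner_left ℂ fun χ => ?_
  rw [inner_zero_right, ← ContinuousLinearMap.adjoint_inner_left]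
  have hint := L2.integrable_inner (𝕜 := ℂ) (ContinuousLinearMap.adjoint A χ) (B φ)
  have hlim := tendsto_setIntegral_of_monotone hF hmono
    (hint.integrableOn (s := ⋃ N, F N))
  rw [hcov, setIntegral_univ, ← L2.inner_def] at hlim
  refine tendsto_nhds_unique hlim ?_
  refine tendsto_const_nhds.congr fun N => ?_
  have : inner ℂ (ContinuousLinearMap.adjoint A χ) (proj (F N) (hF N) (B φ)) = 0 := by
    rw [ContinuousLinearMap.adjoint_inner_left]
    have := congrArg (fun T : L2 d →L[ℂ] L2 d => T φ) (hz N)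
    simp only [mul_apply_eq_comp, zero_apply] at this
    rw [this, inner_zero_right]
  rw [← this, L2.inner_def, ← integral_indicator (hF N)]
  apply integral_congr_ae
  filter_upwards [proj_coeFn (F N) (hF N) (B φ)] with x hx
  rw [hx]
  by_cases h' : x ∈ F N <;> simp [h']

/-! ### The standard C⋆-algebra and its ideals -/

/-- The set `𝒜_m` of operators of propagation at most `m`. -/
def finProp (d m : ℕ) : Set (L2 d →L[ℂ] L2 d) :=
  {A | ∀ (a b : Eu d) (r s : ℝ), 0 < r → 0 < s →
    proj (ball a r) measurableSet_ball * A * proj (ball b s) measurableSet_ball ≠ 0 →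
      dist a b ≤ r + s + m}

theorem finProp_mono {m n : ℕ} (h : m ≤ n) : finProp d m ⊆ finProp d n := by
  intro A hA a b r s hr hs hne
  have := hA a b r s hr hs hne
  have h' : (m : ℝ) ≤ n := by exact_mod_cast h
  linarith

theorem finProp_add {m : ℕ} {A B : L2 d →L[ℂ] L2 d} (hA : A ∈ finProp d m)
    (hB : B ∈ finProp d m) : A + B ∈ finProp d m := by
  intro a b r s hr hs hne
  by_contra hcon
  apply hne
  have h1 : proj (ball a r) measurableSet_ball * A * proj (ball b s) measurableSet_ball = 0 :=
    not_not.1 fun h => hcon (hA a b r s hr hs h)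
  have h2 : proj (ball a r) measurableSet_ball * B * proj (ball b s) measurableSet_ball = 0 :=
    not_not.1 fun h => hcon (hB a b r s hr hs h)
  rw [mul_add, add_mul, h1, h2, add_zero]

theorem finProp_mul {m n : ℕ} {A B : L2 d →L[ℂ] L2 d} (hA : A ∈ finProp d m)
    (hB : B ∈ finProp d n) : A * B ∈ finProp d (m + n) := by
  intro a b r s hr hs hne
  refine le_of_forall_pos_le_add fun ε hε => ?_
  rw [← mul_assoc, mul_assoc _ B] at hne
  obtain ⟨c, h1, h2⟩ := exists_ball_of_mul_ne_zero hne (half_pos hε)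
  rw [← mul_assoc] at h2
  have h3 := hA a c r (ε / 2) hr (half_pos hε) h1
  have h4 := hB c b (ε / 2) s (half_pos hε) hs h2
  have h5 := dist_triangle a c b
  push_cast
  linarith

theorem finProp_star {m : ℕ} {A : L2 d →L[ℂ] L2 d} (hA : A ∈ finProp d m) :
    star A ∈ finProp d m := by
  intro a b r s hr hs hne
  have h : proj (ball b s) measurableSet_ball * A * proj (ball a r) measurableSet_ball ≠ 0 := by
    intro h
    apply hne
    have := congrArg star h
    rwa [star_mul, star_mul, star_proj, star_proj, star_zero, ← mul_assoc] at this
  have := hA b a s r hs hr h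
  rw [dist_comm]
  linarith

theorem finProp_algebraMap (c : ℂ) : algebraMap ℂ (L2 d →L[ℂ] L2 d) c ∈ finProp d 0 := by
  intro a b r s hr hs hne
  by_contra hcon
  apply hne
  rw [← Algebra.commutes, mul_assoc, proj_mul_eq_zero, mul_zero]
  rw [← disjoint_iff_inter_eq_empty]
  apply ball_disjoint_ball
  push_cast at hcon
  linarith

/-- The ⋆-algebra `⋃ₘ 𝒜_m` of operators of finite propagation. -/
noncomputable def finPropAlgebra (d : ℕ) : StarSubalgebra ℂ (L2 d →L[ℂ] L2 d) where
  carrier := ⋃ m, finProp d m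
  mul_mem' := by
    intro A B hA hB
    obtain ⟨m, hm⟩ := mem_iUnion.1 hA
    obtain ⟨n, hn⟩ := mem_iUnion.1 hB
    exact mem_iUnion.2 ⟨m + n, finProp_mul hm hn⟩
  add_mem' := by
    intro A B hA hB
    obtain ⟨m, hm⟩ := mem_iUnion.1 hA
    obtain ⟨n, hn⟩ := mem_iUnion.1 hB
    exact mem_iUnion.2 ⟨max m n, finProp_add (finProp_mono (le_max_left _ _) hm)
      (finProp_mono (le_max_right _ _) hn)⟩
  algebraMap_mem' := fun c => mem_iUnion.2 ⟨0, finProp_algebraMap c⟩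
  star_mem' := by
    intro A hA
    obtain ⟨m, hm⟩ := mem_iUnion.1 hA
    exact mem_iUnion.2 ⟨m, finProp_star hm⟩

/-- The standard C⋆-algebra `𝒜` of `L²(ℝᵈ)`: the norm closure of `⋃ₘ 𝒜_m`. -/
noncomputable def stdAlgebra (d : ℕ) : StarSubalgebra ℂ (L2 d →L[ℂ] L2 d) :=
  (finPropAlgebra d).topologicalClosure

/-- The projection onto `L²(S(r))`, where `S(r) = {x | dist(x, S) < r}`. -/
noncomputable def nbhdProj (S : Set (Eu d)) (r : ℝ) : L2 d →L[ℂ] L2 d :=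
  proj (thickening r S) isOpen_thickening.measurableSet

/-- The set `𝒥_{S,n}` of all `A ∈ 𝒜` with `A = P_{S(n)} A P_{S(n)}`. -/
def confined (S : Set (Eu d)) (n : ℕ) : Set (stdAlgebra d) :=
  {A | (A : L2 d →L[ℂ] L2 d) = nbhdProj S n * A * nbhdProj S n}

theorem nbhdProj_mul_of_le (S : Set (Eu d)) {r s : ℝ} (h : r ≤ s) :
    nbhdProj S s * nbhdProj S r = nbhdProj S r := by
  rw [nbhdProj, nbhdProj, proj_mul]
  congr 1
  exact inter_eq_right.2 (thickening_mono h S)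

theorem nbhdProj_mul_of_le' (S : Set (Eu d)) {r s : ℝ} (h : r ≤ s) :
    nbhdProj S r * nbhdProj S s = nbhdProj S r := by
  rw [nbhdProj, nbhdProj, proj_mul]
  congr 1
  exact inter_eq_left.2 (thickening_mono h S)

theorem confined_iff {S : Set (Eu d)} {n : ℕ} {A : stdAlgebra d} :
    A ∈ confined S n ↔ nbhdProj S n * (A : L2 d →L[ℂ] L2 d) = A ∧
      (A : L2 d →L[ℂ] L2 d) * nbhdProj S n = A := by
  constructor
  · intro h
    have h' : (A : L2 d →L[ℂ] L2 d) = nbhdProj S n * A * nbhdProj S n := h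
    constructor
    · conv_lhs => rw [h']
      rw [← mul_assoc, ← mul_assoc, nbhdProj_mul_of_le S le_rfl]
      exact h'.symm
    · conv_lhs => rw [h']
      rw [mul_assoc, nbhdProj_mul_of_le S le_rfl]
      exact h'.symm
  · rintro ⟨h1, h2⟩
    change (A : L2 d →L[ℂ] L2 d) = nbhdProj S n * A * nbhdProj S n
    rw [h1, h2]

theorem confined_mono {S : Set (Eu d)} {m n : ℕ} (h : m ≤ n) : confined S m ⊆ confined S n := by
  intro A hA
  have h' : (m : ℝ) ≤ n := by exact_mod_cast h
  rw [confined_iff] at hA ⊢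
  constructor
  · rw [← hA.1, ← mul_assoc, nbhdProj_mul_of_le S h']
  · rw [← hA.2, mul_assoc, nbhdProj_mul_of_le' S h']

/-- An operator of propagation at most `m` maps `L²(S(n))` into `L²(S(n+m+1))`. -/
theorem nbhdProj_finProp {S : Set (Eu d)} {m n : ℕ} {A : L2 d →L[ℂ] L2 d} (hA : A ∈ finProp d m) :
    nbhdProj S (m + n + 1 : ℕ) * A * nbhdProj S n = A * nbhdProj S n := by
  set T := thickening ((m + n + 1 : ℕ) : ℝ) S with hT
  have hTm : MeasurableSet T := isOpen_thickening.measurableSet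
  have key : proj Tᶜ hTm.compl * (A * nbhdProj S n) = 0 := by
    by_contra hne
    obtain ⟨a, h1, h2⟩ := exists_ball_of_mul_ne_zero hne (show (0 : ℝ) < 1 / 8 by norm_num)
    rw [← mul_assoc] at h2
    obtain ⟨b, h3, h4⟩ := exists_ball_of_mul_ne_zero h2 (show (0 : ℝ) < 1 / 8 by norm_num)
    have hd := hA a b _ _ (by norm_num) (by norm_num) h3
    have n1 : (Tᶜ ∩ ball a (1 / 8)).Nonempty := by
      rw [nonempty_iff_ne_empty]
      exact fun h => h1 (proj_mul_eq_zero _ _ _ _ h)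
    have n2 : (ball b (1 / 8) ∩ thickening (n : ℝ) S).Nonempty := by
      rw [nonempty_iff_ne_empty]
      exact fun h => h4 (proj_mul_eq_zero _ _ _ _ h)
    obtain ⟨x, hx, hxa⟩ := n1
    obtain ⟨y, hyb, hy⟩ := n2
    obtain ⟨w, hw, hyw⟩ := mem_thickening_iff.1 hy
    apply hx
    refine mem_thickening_iff.2 ⟨w, hw, ?_⟩
    have t1 := dist_triangle x a w
    have t2 := dist_triangle a b w
    have t3 := dist_triangle b y w
    rw [mem_ball] at hxa hyb
    rw [dist_comm] at hyb
    push_cast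
    linarith
  have := congrArg (fun P => P * (A * nbhdProj S n)) (proj_add_compl T hTm)
  simp only [add_mul, one_mul, key, add_zero] at this
  rw [mul_assoc]
  exact this

theorem finProp_nbhdProj {S : Set (Eu d)} {m n : ℕ} {A : L2 d →L[ℂ] L2 d} (hA : A ∈ finProp d m) :
    nbhdProj S n * A * nbhdProj S (m + n + 1 : ℕ) = nbhdProj S n * A := by
  have := congrArg star (nbhdProj_finProp (S := S) (n := n) (finProp_star hA))
  simp only [star_mul, star_star, nbhdProj, star_proj] at this
  simp only [nbhdProj, mul_assoc]
  exact this

theorem confined_add {S : Set (Eu d)} {n : ℕ} {A B : stdAlgebra d} (hA : A ∈ confined S n)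
    (hB : B ∈ confined S n) : A + B ∈ confined S n := by
  rw [confined_iff] at *
  have e : ((A + B : stdAlgebra d) : L2 d →L[ℂ] L2 d) = A + B := rfl
  rw [e, mul_add, add_mul, hA.1, hB.1, hA.2, hB.2]
  exact ⟨rfl, rfl⟩

theorem mul_confined {S : Set (Eu d)} {m n : ℕ} {A B : stdAlgebra d}
    (hA : (A : L2 d →L[ℂ] L2 d) ∈ finProp d m) (hB : B ∈ confined S n) :
    A * B ∈ confined S (m + n + 1) := by
  have hB' := confined_iff.1 (confined_mono (show n ≤ m + n + 1 by omega) hB)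
  rw [confined_iff] at *
  have e : ((A * B : stdAlgebra d) : L2 d →L[ℂ] L2 d) = A * B := rfl
  rw [e]
  constructor
  · rw [← hB.1, ← mul_assoc, ← mul_assoc, ← mul_assoc, nbhdProj_finProp hA]
  · rw [mul_assoc, hB'.2]

theorem confined_mul {S : Set (Eu d)} {m n : ℕ} {A B : stdAlgebra d}
    (hA : (A : L2 d →L[ℂ] L2 d) ∈ finProp d m) (hB : B ∈ confined S n) :
    B * A ∈ confined S (m + n + 1) := by
  have hB' := confined_iff.1 (confined_mono (show n ≤ m + n + 1 by omega) hB)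
  rw [confined_iff] at *
  have e : ((B * A : stdAlgebra d) : L2 d →L[ℂ] L2 d) = B * A := rfl
  rw [e]
  constructor
  · rw [← mul_assoc, hB'.1]
  · rw [← hB.2, mul_assoc, mul_assoc, ← mul_assoc (nbhdProj S n), finProp_nbhdProj hA, ← mul_assoc]

/-- The union `⋃_{n ≥ 1} 𝒥_{S,n}`. -/
def confinedUnion (S : Set (Eu d)) : Set (stdAlgebra d) := ⋃ n ∈ Ici 1, confined S n

theorem mem_confinedUnion {S : Set (Eu d)} {A : stdAlgebra d} :
    A ∈ confinedUnion S ↔ ∃ n, A ∈ confined S n := by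
  simp only [confinedUnion, mem_iUnion, mem_Ici, exists_prop]
  constructor
  · rintro ⟨n, -, h⟩
    exact ⟨n, h⟩
  · rintro ⟨n, h⟩
    exact ⟨n + 1, by omega, confined_mono (Nat.le_succ n) h⟩

theorem dense_finProp : Dense {A : stdAlgebra d | (A : L2 d →L[ℂ] L2 d) ∈ finPropAlgebra d} := by
  intro A
  rw [closure_subtype]
  have hA : (A : L2 d →L[ℂ] L2 d) ∈ closure (finPropAlgebra d : Set (L2 d →L[ℂ] L2 d)) := A.2
  refine closure_mono ?_ hA
  intro B hB
  exact ⟨⟨B, StarSubalgebra.le_topologicalClosure _ hB⟩, hB, rfl⟩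

theorem mul_mem_closure_confined {S : Set (Eu d)} (A : stdAlgebra d) {B : stdAlgebra d}
    (hB : B ∈ closure (confinedUnion S)) :
    A * B ∈ closure (confinedUnion S) ∧ B * A ∈ closure (confinedUnion S) := by
  have hA := dense_finProp A
  constructor
  · refine map_mem_closure₂ continuous_mul hA hB fun A' hA' B' hB' => ?_
    obtain ⟨m, hm⟩ := mem_iUnion.1 hA'
    obtain ⟨n, hn⟩ := mem_confinedUnion.1 hB'
    exact mem_confinedUnion.2 ⟨_, mul_confined hm hn⟩
  · refine map_mem_closure₂ continuous_mul hB hA fun B' hB' A' hA' => ?_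
    obtain ⟨m, hm⟩ := mem_iUnion.1 hA'
    obtain ⟨n, hn⟩ := mem_confinedUnion.1 hB'
    exact mem_confinedUnion.2 ⟨_, confined_mul hm hn⟩

/-- The closed two-sided ideal `𝒥_S` of `𝒜`: the norm closure of `⋃_{n ≥ 1} 𝒥_{S,n}`. -/
def idealOf (S : Set (Eu d)) : Ideal (stdAlgebra d) where
  carrier := closure (confinedUnion S)
  zero_mem' := subset_closure (mem_confinedUnion.2 ⟨0, confined_iff.2
    ⟨mul_zero (nbhdProj S (0 : ℕ)), zero_mul (nbhdProj S (0 : ℕ))⟩⟩)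
  add_mem' := by
    intro A B hA hB
    refine map_mem_closure₂ continuous_add hA hB fun A' hA' B' hB' => ?_
    obtain ⟨m, hm⟩ := mem_confinedUnion.1 hA'
    obtain ⟨n, hn⟩ := mem_confinedUnion.1 hB'
    exact mem_confinedUnion.2 ⟨max m n, confined_add (confined_mono (le_max_left _ _) hm)
      (confined_mono (le_max_right _ _) hn)⟩
  smul_mem' := fun A _ hB => (mul_mem_closure_confined A hB).1

instance (S : Set (Eu d)) : (idealOf S).IsTwoSided :=
  ⟨fun {_} A hB => (mul_mem_closure_confined A hB).2⟩

/-- A closed operator is affiliated to `𝒜` if one of its resolvent operators lies in `𝒜`. -/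
def Affiliated (A : L2 d →ₗ.[ℂ] L2 d) : Prop :=
  A.IsClosed ∧ ∃ z ∈ resolventSet A, resolvent A z ∈ stdAlgebra d

/-- `σ_S(A)`: the spectrum of the pseudo-resolvent obtained by mapping the resolvent operators of
`A` that lie in `𝒜` to the quotient `𝒜 / 𝒥_S`. -/
def specAt (S : Set (Eu d)) (A : L2 d →ₗ.[ℂ] L2 d) : Set ℂ :=
  pseudoSpectrum {α | α ∈ resolventSet A ∧ resolvent A α ∈ stdAlgebra d}
    fun α => Ideal.Quotient.mk (idealOf S) ⟨resolvent A α, α.2.2⟩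

/-! ### The Laplacian and relatively bounded potentials -/

/-- `H₀ = -Δ` on `L²(ℝᵈ)`: the operator `ℱ⁻¹ p ℱ` with `p(ξ) = 4π²|ξ|²` on the domain
`{φ | p ℱφ ∈ L²}`; the Fourier transform is `∫ φ(x) exp(-2πi x·ξ) dx`. -/
noncomputable def negLaplacian (d : ℕ) : L2 d →ₗ.[ℂ] L2 d :=
  let F := Lp.fourierTransformₗᵢ (Eu d) ℂ
  let M : L2 d →ₗ.[ℂ] L2 d := mulOp fun ξ => ((4 * Real.pi ^ 2 * ‖ξ‖ ^ 2 : ℝ) : ℂ)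
  { domain := M.domain.comap F.toLinearEquiv.toLinearMap
    toFun := F.symm.toLinearEquiv.toLinearMap ∘ₗ M.toFun ∘ₗ
      F.toLinearEquiv.toLinearMap.restrict (fun _ h => h) }

/-- The relative norm `‖V‖_A = sup {‖V (A φ)‖ : ‖φ‖ ≤ 1}`, as an extended real. -/
noncomputable def relNorm (A : L2 d →L[ℂ] L2 d) (V : Eu d → ℂ) : ℝ≥0∞ :=
  ⨆ φ : closedBall (0 : L2 d) 1, eLpNorm (fun x => V x * (A φ) x) 2 volume

/-- The space `𝒱_A`: the closure of `L^∞` in the space of potentials of finite relative norm. -/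
def potentials (A : L2 d →L[ℂ] L2 d) : Set (Eu d → ℂ) :=
  {V | AEStronglyMeasurable V volume ∧ relNorm A V < ∞ ∧
    ∀ ε : ℝ≥0∞, 0 < ε → ∃ U : Eu d → ℂ, MemLp U ∞ volume ∧ relNorm A (V - U) < ε}

/-- `R₀ = (a + H₀)⁻¹`. -/
noncomputable def freeResolvent (d : ℕ) (a : ℝ) : L2 d →L[ℂ] L2 d :=
  -resolvent (negLaplacian d) (-(a : ℂ))

/-- The Schrödinger operator `H₀ + V`, an operator sum with domain `Dom(H₀) ∩ Dom(V)`. -/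
noncomputable def schrodinger (V : Eu d → ℂ) : L2 d →ₗ.[ℂ] L2 d := negLaplacian d + mulOp V

end DaviesSpectra

/-! At the single point `α = -a`, each spectrum records when `T = 1 + (z + a) R(-a)` fails to be
invertible: in the bounded operators, modulo the compacts, or modulo `𝒥_S`. The theorem thus
compares three kinds of invertibility of one operator.

Invertible implies invertible modulo compacts, trivially. Invertible modulo compacts implies
invertible modulo `𝒥_S` (`isUnit_mk_idealOf_of_compactIdeal`): a compact error is small off a large
ball with projection `P`, so `T` is bounded below up to `P` and `T*T + P*P` is invertible. Its
inverse stays in `𝒜` by spectral permanence, and `P` lies in `𝒥_S`. The same applies to `T*`.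

For periodic `W` the circle closes (`isUnit_of_isUnit_mk_idealOf`). An element of `𝒥_S` is small off
some `S(n)`, so `T` is bounded below up to `P_{S(n)}`; since `T` commutes with translations carrying
any vector away from `S(n)`, the correction disappears. Finally, the resolvents of `H₀ + W` and `H`
differ by an element of `𝒥_S` (`resolvent_schrodinger_sub_mem_idealOf`), so `σ_S` does not see `X`.

Affiliation rests on `R₀ ∈ 𝒜`: its symbol vanishes at infinity, hence is a uniform limit of Fourier
transforms of compactly supported integrable functions, which give operators of finite propagation.
The factorization `R(-a) = -R₀ (1 + V R₀)⁻¹` does the rest. -/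

namespace DaviesSpectra

open MeasureTheory Metric Set Filter
open scoped ENNReal Topology NNReal FourierTransform

/-! ### Pseudo-resolvents and invertibility modulo an ideal. -/

section Abstract

/-- For a family satisfying the resolvent identity, invertibility of `1 + (z - α) r_α` does not
depend on `α`. -/
theorem pseudoSpectrum_eq {B : Type*} [Ring B] [Algebra ℂ B] {U : Set ℂ} {r : U → B}
    (hr : ∀ α β : U, r α - r β = ((β : ℂ) - α) • (r α * r β)) (α : U) :
    pseudoSpectrum U r = {z | ¬ IsUnit (1 + (z - (α : ℂ)) • r α)} := by
  -- Formally `1 + (z - β) r_β = (z - A)(β - A)⁻¹`, and these quotients multiply.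
  have key : ∀ (β γ : U) (z : ℂ),
      (1 + ((γ : ℂ) - β) • r β) * (1 + (z - (γ : ℂ)) • r γ) = 1 + (z - (β : ℂ)) • r β := by
    intro β γ z
    have h := hr β γ
    have e : r γ = r β - ((γ : ℂ) - β) • (r β * r γ) := by rw [← h]; abel
    calc (1 + ((γ : ℂ) - β) • r β) * (1 + (z - (γ : ℂ)) • r γ)
        = 1 + ((γ : ℂ) - β) • r β +
            (z - (γ : ℂ)) • (r γ + ((γ : ℂ) - β) • (r β * r γ)) := by
          simp only [add_mul, mul_add, one_mul, mul_one, smul_mul_smul_comm, smul_add, smul_smul,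
            mul_comm (z - (γ : ℂ))]
      _ = 1 + ((γ : ℂ) - β) • r β + (z - (γ : ℂ)) • r β := by
          rw [show r γ + ((γ : ℂ) - β) • (r β * r γ) = r β by rw [← h]; abel]
      _ = 1 + (z - (β : ℂ)) • r β := by module
  -- Exchanging the two base points gives the inverse factor.
  have hu : ∀ β γ : U, IsUnit (1 + ((γ : ℂ) - β) • r β) := by
    intro β γ
    have h1 := key β γ β
    have h2 := key γ β γ
    rw [sub_self, zero_smul, add_zero] at h1 h2
    exact ⟨⟨_, _, h1, h2⟩, rfl⟩
  ext z
  refine ⟨fun h => h α, fun h β hβ => h ?_⟩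
  rw [← key α β z]
  exact (hu α β).mul hβ

/-- The left and right parametrices may be different elements; their classes coincide in the
quotient. -/
theorem isUnit_mk_iff {R : Type*} [Ring R] (I : Ideal R) [I.IsTwoSided] {t : R} :
    IsUnit (Ideal.Quotient.mk I t) ↔ (∃ q, q * t - 1 ∈ I) ∧ ∃ q, t * q - 1 ∈ I := by
  constructor
  · rintro ⟨u, hu⟩
    obtain ⟨q, hq⟩ := Ideal.Quotient.mk_surjective (I := I) u⁻¹.val
    refine ⟨⟨q, ?_⟩, ⟨q, ?_⟩⟩
    · rw [← Ideal.Quotient.eq, map_mul, hq, ← hu, u.inv_mul, map_one]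
    · rw [← Ideal.Quotient.eq, map_mul, hq, ← hu, u.mul_inv, map_one]
  · rintro ⟨⟨q, hq⟩, ⟨q', hq'⟩⟩
    rw [← Ideal.Quotient.eq, map_mul, map_one] at hq hq'
    exact ⟨⟨_, _, hq', left_inv_eq_right_inv hq hq' ▸ hq⟩, rfl⟩

/-- Applied with `s = t*` and `p = p' = P*P`: a coercivity estimate up to `P` then produces
parametrices on both sides. -/
theorem isUnit_mk_of_isUnit_add {R : Type*} [Ring R] (I : Ideal R) [I.IsTwoSided] {s t p p' : R}
    (hp : p ∈ I) (hp' : p' ∈ I) (h : IsUnit (s * t + p)) (h' : IsUnit (t * s + p')) :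
    IsUnit (Ideal.Quotient.mk I t) := by
  obtain ⟨u, hu⟩ := h
  obtain ⟨v, hv⟩ := h'
  refine (isUnit_mk_iff _).2 ⟨⟨u⁻¹.val * s, ?_⟩, ⟨s * v⁻¹.val, ?_⟩⟩
  · have : u⁻¹.val * s * t - 1 = -u⁻¹.val * p := by
      rw [← u.inv_mul, hu]
      noncomm_ring
    rw [this]
    exact I.mul_mem_left _ hp
  · have : t * (s * v⁻¹.val) - 1 = p' * -v⁻¹.val := by
      rw [← v.mul_inv, hv]
      noncomm_ring
    rw [this]
    exact I.mul_mem_right _ hp'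

theorem mk_one_add_smul_eq {R : Type*} [Ring R] [Algebra ℂ R] (I : Ideal R) [I.IsTwoSided]
    {x y : R} (h : x - y ∈ I) (c : ℂ) :
    Ideal.Quotient.mk I (1 + c • x) = Ideal.Quotient.mk I (1 + c • y) := by
  rw [Ideal.Quotient.eq, add_sub_add_left_eq_sub, ← smul_sub, Algebra.smul_def]
  exact I.mul_mem_left _ h

/-! ### Resolvents of unbounded operators. -/

variable {H : Type*} [NormedAddCommGroup H] [NormedSpace ℂ H]

theorem IsResolventAt.exists_dom {A : H →ₗ.[ℂ] H} {z : ℂ} {R : H →L[ℂ] H}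
    (h : IsResolventAt A z R) (φ : H) : ∃ y : A.domain, (y : H) = R φ ∧ z • (y : H) - A y = φ := by
  obtain ⟨hm, e⟩ := h.1 φ
  exact ⟨⟨_, hm⟩, rfl, e⟩

theorem isResolventAt_of_exists {A : H →ₗ.[ℂ] H} {z : ℂ} {R : H →L[ℂ] H}
    (h : ∀ φ : H, ∃ y : A.domain, (y : H) = R φ ∧ z • (y : H) - A y = φ)
    (h' : ∀ ψ : A.domain, R (z • (ψ : H) - A ψ) = ψ) : IsResolventAt A z R := by
  refine ⟨fun φ => ?_, h'⟩
  obtain ⟨⟨y, hy⟩, rfl, e⟩ := h φ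
  exact ⟨hy, e⟩

theorem IsResolventAt.mem {A : H →ₗ.[ℂ] H} {z : ℂ} {R : H →L[ℂ] H}
    (h : IsResolventAt A z R) : z ∈ resolventSet A := ⟨R, h⟩

theorem IsResolventAt.resolvent_eq {A : H →ₗ.[ℂ] H} {z : ℂ} {R : H →L[ℂ] H}
    (h : IsResolventAt A z R) : resolvent A z = R := (isResolventAt_resolvent h.mem).unique h

/-- The first resolvent identity. -/
theorem resolvent_sub_resolvent {A : H →ₗ.[ℂ] H} {α β : ℂ} (hα : α ∈ resolventSet A)
    (hβ : β ∈ resolventSet A) :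
    resolvent A α - resolvent A β = (β - α) • (resolvent A α * resolvent A β) := by
  ext φ
  obtain ⟨y, hy, e⟩ := (isResolventAt_resolvent hβ).exists_dom φ
  have h2 := (isResolventAt_resolvent hα).2 y
  have e' : A y = β • (y : H) - φ := by rw [← e]; abel
  have e2 : α • (y : H) - A y = φ - (β - α) • (y : H) := by rw [e']; module
  rw [e2, map_sub, map_smul] at h2
  simp only [sub_apply, smul_apply, mul_apply_eq_comp]
  rw [← hy, sub_eq_iff_eq_add', ← sub_eq_iff_eq_add]
  exact h2

/-- Since `1 + (z - α) R(α) = (z - A) R(α)`, the inverse of `z - A` must be `R(α) u⁻¹`; it is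
two-sided because `u` commutes with `R(α)`. -/
theorem mem_resolventSet_of_isUnit {A : H →ₗ.[ℂ] H} {α z : ℂ} (hα : α ∈ resolventSet A)
    (h : IsUnit (1 + (z - α) • resolvent A α)) : z ∈ resolventSet A := by
  obtain ⟨u, hu⟩ := h
  have hR := isResolventAt_resolvent hα
  have h1 : ∀ φ, u⁻¹.val φ + (z - α) • resolvent A α (u⁻¹.val φ) = φ := by
    intro φ
    have := congrArg (fun T : H →L[ℂ] H => T φ) u.mul_inv
    rw [hu] at this
    simpa using this
  have h2 : ∀ φ, u⁻¹.val (φ + (z - α) • resolvent A α φ) = φ := by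
    intro φ
    have := congrArg (fun T : H →L[ℂ] H => T φ) u.inv_mul
    rw [hu] at this
    simpa using this
  have h3 : u⁻¹.val * resolvent A α = resolvent A α * u⁻¹.val := by
    have : Commute (u : H →L[ℂ] H) (resolvent A α) := by
      rw [hu]
      exact (Commute.one_left _).add_left ((Commute.refl _).smul_left _)
    exact this.units_inv_left
  refine ⟨resolvent A α * u⁻¹.val, isResolventAt_of_exists (fun φ => ?_) fun ψ => ?_⟩
  · obtain ⟨y, hy, e⟩ := hR.exists_dom (u⁻¹.val φ)
    refine ⟨y, hy, ?_⟩
    conv_rhs => rw [← h1 φ, ← e, e, ← hy]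
    rw [← e]
    module
  · have : z • (ψ : H) - A ψ = (α • (ψ : H) - A ψ) + (z - α) • (ψ : H) := by module
    rw [← h3, mul_apply_eq_comp, this, map_add, hR.2 ψ, map_smul, h2]

/-- The graph is the solution set of the continuous equation `R(α)(α x - y) = x`. -/
theorem isClosed_of_mem_resolventSet {A : H →ₗ.[ℂ] H} {α : ℂ} (hα : α ∈ resolventSet A) :
    A.IsClosed := by
  have hR := isResolventAt_resolvent hα
  have : (A.graph : Set (H × H)) = {p | resolvent A α (α • p.1 - p.2) = p.1} := by
    ext ⟨x, y⟩
    simp only [SetLike.mem_coe, LinearPMap.mem_graph_iff, mem_ofPred_eq]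
    constructor
    · rintro ⟨ψ, rfl, rfl⟩
      exact hR.2 ψ
    · intro h
      obtain ⟨ψ, hψ, e⟩ := hR.exists_dom (α • x - y)
      rw [h] at hψ
      subst hψ
      exact ⟨ψ, rfl, sub_right_injective e⟩
  change IsClosed (A.graph : Set (H × H))
  rw [this]
  exact isClosed_eq (by fun_prop) (by fun_prop)

theorem essSpec_subset_spec (A : H →ₗ.[ℂ] H) : essSpec A ⊆ spec A := by
  intro z hz hz'
  -- With base point `α = z` the element to invert is `1`.
  apply hz ⟨z, hz'⟩
  simp

theorem essSpec_eq {A : H →ₗ.[ℂ] H} {α : ℂ} (hα : α ∈ resolventSet A) :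
    essSpec A =
      {z | ¬ IsUnit (Ideal.Quotient.mk (compactIdeal H) (1 + (z - α) • resolvent A α))} := by
  rw [essSpec, pseudoSpectrum_eq _ ⟨α, hα⟩]
  · rfl
  · intro β γ
    rw [← map_sub, resolvent_sub_resolvent β.2 γ.2]
    rfl

/-! ### Lower bounds and compactness on Hilbert space. -/

variable {E : Type*} [NormedAddCommGroup E] [InnerProductSpace ℂ E] [CompleteSpace E]

theorem inner_star_mul_self (T : E →L[ℂ] E) (x : E) :
    inner ℂ ((star T * T) x) x = ((‖T x‖ ^ 2 : ℝ) : ℂ) := by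
  rw [mul_apply_eq_comp, ContinuousLinearMap.star_eq_adjoint,
    ContinuousLinearMap.adjoint_inner_left, inner_self_eq_norm_sq_to_K]
  push_cast
  rfl

/-- The quadratic form is `‖Tx‖² + ‖Px‖²`, which is coercive; the constant `c²/2` comes from `(s +
t)² ≤ 2(s² + t²)`. -/
theorem isUnit_star_mul_self_add (T P : E →L[ℂ] E) {c : ℝ} (hc : 0 < c)
    (h : ∀ x, c * ‖x‖ ≤ ‖T x‖ + ‖P x‖) : IsUnit (star T * T + star P * P) := by
  refine ContinuousLinearMap.isUnit_of_forall_le_norm_inner_map _ (c := ⟨c ^ 2 / 2, by positivity⟩)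
    (by change 0 < c ^ 2 / 2; positivity) fun x => ?_
  rw [add_apply, inner_add_left, inner_star_mul_self, inner_star_mul_self, ← Complex.ofReal_add,
    Complex.norm_real, Real.norm_of_nonneg (by positivity)]
  change ‖x‖ ^ 2 * (c ^ 2 / 2) ≤ _
  have h1 : (c * ‖x‖) ^ 2 ≤ (‖T x‖ + ‖P x‖) ^ 2 := by gcongr; exact h x
  nlinarith [sq_nonneg (‖T x‖ - ‖P x‖)]

theorem isUnit_of_bounded_below {T : E →L[ℂ] E} {c c' : ℝ} (hc : 0 < c) (hc' : 0 < c')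
    (h : ∀ x, c * ‖x‖ ≤ ‖T x‖) (h' : ∀ x, c' * ‖x‖ ≤ ‖star T x‖) : IsUnit T := by
  have h1 := isUnit_star_mul_self_add T 0 hc (by simpa using h)
  have h2 := isUnit_star_mul_self_add (star T) 0 hc' (by simpa using h')
  simp only [star_star, mul_zero, add_zero] at h1 h2
  obtain ⟨u, hu⟩ := h1
  obtain ⟨v, hv⟩ := h2
  have e1 : (u⁻¹.val * star T) * T = 1 := by rw [mul_assoc, ← hu, u.inv_mul]
  have e2 : T * (star T * v⁻¹.val) = 1 := by rw [← mul_assoc, ← hv, v.mul_inv]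
  exact ⟨⟨T, _, e2, left_inv_eq_right_inv e1 e2 ▸ e1⟩, rfl⟩

omit [CompleteSpace E] in
/-- A bounded sequence of operators tending strongly to zero tends to zero in norm after
composition with a compact operator. -/
theorem tendsto_mul_compact {Q : ℕ → E →L[ℂ] E} {K : E →L[ℂ] E} (hQ : ∀ n, ‖Q n‖ ≤ 1)
    (hQ' : ∀ x, Tendsto (fun n => Q n x) atTop (𝓝 0)) (hK : IsCompactOperator K) :
    Tendsto (fun n => Q n * K) atTop (𝓝 0) := by
  rw [Metric.tendsto_atTop']
  intro ε hε
  obtain ⟨C, hC, hKC⟩ := IsCompactOperator.image_closedBall_subset_compact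
    (f := (K : E →ₗ[ℂ] E)) hK 1
  -- Strong convergence is uniform on a finite net of the image of the unit ball. Net error and
  -- value on the net, `ε/4` each, give `ε/2` and hence a strict bound by `ε`.
  obtain ⟨t, -, ht, hCt⟩ := hC.finite_cover_balls (show 0 < ε / 4 by positivity)
  have : ∀ᶠ n in atTop, ∀ y ∈ t, ‖Q n y‖ < ε / 4 := by
    rw [eventually_all_finite ht]
    intro y _
    have := (hQ' y).norm
    rw [norm_zero] at this
    exact this.eventually_lt_const (by positivity)
  obtain ⟨N, hN⟩ := eventually_atTop.1 this
  refine ⟨N, fun n hn => ?_⟩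
  rw [dist_zero_right]
  refine lt_of_le_of_lt (ContinuousLinearMap.opNorm_le_of_unit_norm (C := ε / 2) (by positivity)
    fun x hx => ?_) (half_lt_self hε)
  have hx' : K x ∈ C := hKC ⟨x, by simp [hx], rfl⟩
  obtain ⟨y, hy, hxy⟩ := mem_iUnion₂.1 (hCt hx')
  rw [mem_ball, dist_eq_norm] at hxy
  have h1 : ‖Q n (K x - y)‖ ≤ 1 * ‖K x - y‖ := (Q n).le_of_opNorm_le (hQ n) _
  have h2 := hN n hn.le y hy
  calc ‖(Q n * K) x‖ = ‖Q n (K x - y) + Q n y‖ := by rw [← map_add]; simp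
    _ ≤ ‖Q n (K x - y)‖ + ‖Q n y‖ := norm_add_le _ _
    _ ≤ ε / 2 := by linarith

/-- The C⋆-identity gives `‖K Q‖² = ‖Q K*K Q‖ ≤ ‖Q K*K‖`, which reduces to left multiplication on
the compact operator `K*K`; compactness of `K*` is not needed. -/
theorem tendsto_compact_mul {Q : ℕ → E →L[ℂ] E} {K : E →L[ℂ] E} (hQ : ∀ n, ‖Q n‖ ≤ 1)
    (hQs : ∀ n, star (Q n) = Q n)
    (hQ' : ∀ x, Tendsto (fun n => Q n x) atTop (𝓝 0)) (hK : IsCompactOperator K) :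
    Tendsto (fun n => K * Q n) atTop (𝓝 0) := by
  have h := (tendsto_mul_compact (K := star K * K) hQ hQ' (hK.clm_comp (star K))).norm
  have h' : Tendsto (fun n => √‖Q n * (star K * K)‖) atTop (𝓝 0) := by
    simpa using h.sqrt
  refine squeeze_zero_norm (fun n => ?_) h'
  apply Real.le_sqrt_of_sq_le
  rw [sq, ← CStarRing.norm_star_mul_self, star_mul, hQs]
  calc ‖Q n * star K * (K * Q n)‖ = ‖Q n * (star K * K) * Q n‖ := by simp only [mul_assoc]
    _ ≤ ‖Q n * (star K * K)‖ * ‖Q n‖ := norm_mul_le _ _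
    _ ≤ _ := mul_le_of_le_one_right (norm_nonneg _) (hQ n)

omit [CompleteSpace E] in
/-- An operator that is left invertible up to an operator `k` small off the range of `P` is bounded
below up to `P`. -/
theorem bounded_below_of_mul_eq {Q T k P : E →L[ℂ] E} (h : Q * T = 1 + k)
    (hk : ‖k * (1 - P)‖ ≤ 1 / 2) : ∃ c > 0, ∀ x, c * ‖x‖ ≤ ‖T x‖ + ‖P x‖ := by
  refine ⟨1 / (2 * (‖Q‖ + ‖k‖ + 1)), by positivity, fun x => ?_⟩
  -- Splitting `k` along `P` leaves a middle term of norm at most `‖x‖/2`, which is absorbed on the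
  -- left.
  have e : x = Q (T x) - (k * (1 - P)) x - k (P x) := by
    have := congrArg (fun S : E →L[ℂ] E => S x) h
    simp only [mul_apply_eq_comp, add_apply, one_apply_eq_self] at this
    rw [this]
    simp only [mul_apply_eq_comp, sub_apply, one_apply_eq_self, map_sub]
    abel
  have h1 : ‖x‖ ≤ ‖Q‖ * ‖T x‖ + 1 / 2 * ‖x‖ + ‖k‖ * ‖P x‖ := by
    conv_lhs => rw [e]
    refine (norm_sub_le _ _).trans (add_le_add ((norm_sub_le _ _).trans (add_le_add ?_ ?_)) ?_)
    · exact Q.le_opNorm _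
    · exact ContinuousLinearMap.le_of_opNorm_le _ hk _
    · exact k.le_opNorm _
  rw [one_div_mul_eq_div, div_le_iff₀ (by positivity)]
  nlinarith [norm_nonneg (T x), norm_nonneg (P x), norm_nonneg Q, norm_nonneg k,
    mul_nonneg (norm_nonneg k) (norm_nonneg (T x)), mul_nonneg (norm_nonneg Q) (norm_nonneg (P x))]

end Abstract

/-! ### Bounded and relatively bounded multiplication operators. -/

variable {d : ℕ}

theorem eLpNorm_le_relNorm (A : L2 d →L[ℂ] L2 d) (V : Eu d → ℂ) (φ : L2 d) :
    eLpNorm (fun x => V x * A φ x) 2 volume ≤ ENNReal.ofReal ‖φ‖ * relNorm A V := by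
  by_cases h : ‖φ‖ = 0
  · rw [norm_eq_zero.1 h, map_zero, eLpNorm_congr_ae (mul_zero_ae V)]
    simp
  have h0 : (‖φ‖ : ℂ) ≠ 0 := by exact_mod_cast h
  have e : A φ = (‖φ‖ : ℂ) • A ((‖φ‖ : ℂ)⁻¹ • φ) := by
    rw [← map_smul, smul_smul, mul_inv_cancel₀ h0, one_smul]
  rw [e, eLpNorm_congr_ae (mul_smul_ae V _ _), eLpNorm_const_smul]
  have h1 : ‖(‖φ‖ : ℂ)‖ₑ = ENNReal.ofReal ‖φ‖ := by
    rw [← ofReal_norm, Complex.norm_real, norm_norm]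
  rw [h1]
  gcongr
  refine le_iSup (fun φ : closedBall (0 : L2 d) 1 => eLpNorm (fun x => V x * (A φ) x) 2 volume)
    ⟨_, ?_⟩
  rw [mem_closedBall_zero_iff, norm_smul, norm_inv, Complex.norm_real, norm_norm,
    inv_mul_cancel₀ h]

theorem memLp_of_relNorm_lt_top {A : L2 d →L[ℂ] L2 d} {V : Eu d → ℂ}
    (hm : AEStronglyMeasurable V volume) (hb : relNorm A V < ∞) (φ : L2 d) :
    MemLp (fun x => V x * A φ x) 2 volume :=
  ⟨hm.mul (Lp.aestronglyMeasurable _),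
    (eLpNorm_le_relNorm A V φ).trans_lt (ENNReal.mul_lt_top ENNReal.ofReal_lt_top hb)⟩

theorem norm_le_of_ae_eq_mul {A : L2 d →L[ℂ] L2 d} {V : Eu d → ℂ} {φ ψ : L2 d}
    (h : (ψ : Eu d → ℂ) =ᵐ[volume] fun x => V x * A φ x) (hb : relNorm A V < ∞) :
    ‖ψ‖ ≤ (relNorm A V).toReal * ‖φ‖ := by
  rw [Lp.norm_def, eLpNorm_congr_ae h, mul_comm]
  refine (ENNReal.toReal_mono (ENNReal.mul_lt_top ENNReal.ofReal_lt_top hb).ne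
    (eLpNorm_le_relNorm A V φ)).trans ?_
  rw [ENNReal.toReal_mul, ENNReal.toReal_ofReal (norm_nonneg _)]

/-- The bounded operator `φ ↦ V (A φ)` for a potential `V` of finite relative norm. -/
noncomputable def relMul (A : L2 d →L[ℂ] L2 d) (V : Eu d → ℂ)
    (hm : AEStronglyMeasurable V volume) (hb : relNorm A V < ∞) : L2 d →L[ℂ] L2 d :=
  LinearMap.mkContinuous
    { toFun := fun φ => (memLp_of_relNorm_lt_top hm hb φ).toLp _
      map_add' := fun φ ψ => toLp_add_of_ae _ _ _ (by rw [map_add]; exact mul_add_ae V _ _)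
      map_smul' := fun c φ => toLp_smul_of_ae c _ _ (by rw [map_smul]; exact mul_smul_ae V c _) }
    (relNorm A V).toReal fun φ =>
      norm_le_of_ae_eq_mul (memLp_of_relNorm_lt_top hm hb φ).coeFn_toLp hb

theorem relMul_coeFn (A : L2 d →L[ℂ] L2 d) (V : Eu d → ℂ)
    (hm : AEStronglyMeasurable V volume) (hb : relNorm A V < ∞) (φ : L2 d) :
    (relMul A V hm hb φ : Eu d → ℂ) =ᵐ[volume] fun x => V x * A φ x :=
  (memLp_of_relNorm_lt_top hm hb φ).coeFn_toLp

theorem norm_le_relNorm {A T : L2 d →L[ℂ] L2 d} {V : Eu d → ℂ}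
    (h : ∀ φ, (T φ : Eu d → ℂ) =ᵐ[volume] fun x => V x * A φ x) (hb : relNorm A V < ∞) :
    ‖T‖ ≤ (relNorm A V).toReal :=
  ContinuousLinearMap.opNorm_le_bound _ ENNReal.toReal_nonneg fun φ =>
    norm_le_of_ae_eq_mul (h φ) hb

/-- Taking `A = 1` makes bounded multiplication a special case of `relMul`. -/
theorem relNorm_one_le {g : Eu d → ℂ} {C : ℝ} (h : ∀ᵐ x : Eu d, ‖g x‖ ≤ C) :
    relNorm 1 g ≤ ENNReal.ofReal C := by
  refine iSup_le fun φ => ?_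
  refine (eLpNorm_le_mul_eLpNorm_of_ae_le_mul (c := C) (g := (φ : L2 d)) ?_ 2).trans ?_
  · filter_upwards [h] with x hx
    rw [norm_mul]
    exact mul_le_mul_of_nonneg_right hx (norm_nonneg _)
  · refine mul_le_of_le_one_right' ?_
    rw [← Lp.enorm_def, ← ofReal_norm, ENNReal.ofReal_le_one]
    exact mem_closedBall_zero_iff.1 φ.2

theorem ae_norm_le_of_memLp_top {g : Eu d → ℂ} (hg : MemLp g ∞ volume) :
    ∀ᵐ x : Eu d, ‖g x‖ ≤ (eLpNorm g ∞ volume).toReal := by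
  rw [eLpNorm_exponent_top]
  have := hg.2
  rw [eLpNorm_exponent_top] at this
  filter_upwards [ae_le_eLpNormEssSup (f := g) (μ := volume)] with x hx
  rw [← toReal_enorm]
  exact ENNReal.toReal_mono this.ne hx

/-- Multiplication by an essentially bounded function. -/
noncomputable def bddMul (g : Eu d → ℂ) (hg : MemLp g ∞ volume) : L2 d →L[ℂ] L2 d :=
  relMul 1 g hg.1 ((relNorm_one_le (ae_norm_le_of_memLp_top hg)).trans_lt ENNReal.ofReal_lt_top)

theorem bddMul_coeFn {g : Eu d → ℂ} (hg : MemLp g ∞ volume) (φ : L2 d) :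
    (bddMul g hg φ : Eu d → ℂ) =ᵐ[volume] fun x => g x * φ x :=
  relMul_coeFn _ _ _ _ φ

theorem norm_bddMul_le {g : Eu d → ℂ} (hg : MemLp g ∞ volume) {C : ℝ} (hC : 0 ≤ C)
    (h : ∀ᵐ x : Eu d, ‖g x‖ ≤ C) : ‖bddMul g hg‖ ≤ C := by
  have h1 := relNorm_one_le h
  refine (norm_le_relNorm (A := 1) (V := g) (bddMul_coeFn hg)
    (h1.trans_lt ENNReal.ofReal_lt_top)).trans ?_
  exact ENNReal.toReal_le_of_le_ofReal hC h1

theorem bddMul_sub {g h : Eu d → ℂ} (hg : MemLp g ∞ volume) (hh : MemLp h ∞ volume) :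
    bddMul g hg - bddMul h hh = bddMul (g - h) (hg.sub hh) := by
  ext1 φ
  apply Lp.ext
  rw [sub_apply]
  filter_upwards [bddMul_coeFn hg φ, bddMul_coeFn hh φ, bddMul_coeFn (hg.sub hh) φ,
    Lp.coeFn_sub (bddMul g hg φ) (bddMul h hh φ)] with x h1 h2 h3 h4
  rw [h4, Pi.sub_apply, h1, h2, h3, Pi.sub_apply, sub_mul]

theorem bddMul_comm {g h : Eu d → ℂ} (hg : MemLp g ∞ volume) (hh : MemLp h ∞ volume) :
    bddMul g hg * bddMul h hh = bddMul h hh * bddMul g hg := by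
  ext1 φ
  apply Lp.ext
  rw [mul_apply_eq_comp, mul_apply_eq_comp]
  filter_upwards [bddMul_coeFn hg φ, bddMul_coeFn hh φ, bddMul_coeFn hg (bddMul h hh φ),
    bddMul_coeFn hh (bddMul g hg φ)] with x h1 h2 h3 h4
  rw [h3, h4, h1, h2, mul_left_comm]

theorem proj_bddMul_comm {g : Eu d → ℂ} (hg : MemLp g ∞ volume) (S : Set (Eu d))
    (hS : MeasurableSet S) : proj S hS * bddMul g hg = bddMul g hg * proj S hS := by
  ext1 φ
  apply Lp.ext
  rw [mul_apply_eq_comp, mul_apply_eq_comp]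
  filter_upwards [proj_coeFn S hS (bddMul g hg φ), proj_coeFn S hS φ, bddMul_coeFn hg φ,
    bddMul_coeFn hg (proj S hS φ)] with x h1 h2 h3 h4
  rw [h1, h4, h2]
  by_cases hx : x ∈ S <;> simp [hx, h3]

/-! ### Multiplication operators in the standard algebra. -/

/-- An operator commuting with all projections `P_S` has propagation zero. -/
theorem finProp_zero_of_commute {A : L2 d →L[ℂ] L2 d}
    (h : ∀ (S : Set (Eu d)) (hS : MeasurableSet S), proj S hS * A = A * proj S hS) :
    A ∈ finProp d 0 := by
  intro a b r s _ _ hne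
  by_contra hcon
  apply hne
  rw [h, mul_assoc, proj_mul_eq_zero, mul_zero]
  rw [← disjoint_iff_inter_eq_empty]
  apply ball_disjoint_ball
  push_cast at hcon
  linarith

theorem finProp_subset_stdAlgebra {m : ℕ} {A : L2 d →L[ℂ] L2 d} (h : A ∈ finProp d m) :
    A ∈ stdAlgebra d :=
  StarSubalgebra.le_topologicalClosure _ (mem_iUnion.2 ⟨m, h⟩ : A ∈ finPropAlgebra d)

instance : IsClosed (stdAlgebra d : Set (L2 d →L[ℂ] L2 d)) :=
  StarSubalgebra.isClosed_topologicalClosure _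

theorem bddMul_mem_stdAlgebra {g : Eu d → ℂ} (hg : MemLp g ∞ volume) :
    bddMul g hg ∈ stdAlgebra d :=
  finProp_subset_stdAlgebra (finProp_zero_of_commute (proj_bddMul_comm hg))

theorem proj_mem_stdAlgebra {S : Set (Eu d)} (hS : MeasurableSet S) : proj S hS ∈ stdAlgebra d :=
  finProp_subset_stdAlgebra (finProp_zero_of_commute fun T hT => proj_comm T S hT hS)

/-! ### Translations and Fourier multipliers -/

/-- The translation operator `φ ↦ φ(· + v)`. -/
noncomputable def translate (v : Eu d) : L2 d →L[ℂ] L2 d :=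
  (Lp.compMeasurePreservingₗᵢ ℂ (fun x : Eu d => x + v)
    (measurePreserving_add_right volume v)).toContinuousLinearMap

theorem translate_coeFn (v : Eu d) (φ : L2 d) :
    (translate v φ : Eu d → ℂ) =ᵐ[volume] fun x => φ (x + v) :=
  Lp.coeFn_compMeasurePreserving φ (measurePreserving_add_right volume v)

theorem norm_translate (v : Eu d) (φ : L2 d) : ‖translate v φ‖ = ‖φ‖ :=
  LinearIsometry.norm_map _ φ

/-- The Fourier transform on `L²(ℝᵈ)`. -/
noncomputable abbrev fourierL2 (d : ℕ) : L2 d ≃ₗᵢ[ℂ] L2 d := Lp.fourierTransformₗᵢ (Eu d) ℂ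

/-- The Fourier multiplier with a bounded symbol. -/
noncomputable def multiplier (g : Eu d → ℂ) (hg : MemLp g ∞ volume) : L2 d →L[ℂ] L2 d :=
  (fourierL2 d).symm.toContinuousLinearEquiv.toContinuousLinearMap ∘L bddMul g hg ∘L
    (fourierL2 d).toContinuousLinearEquiv.toContinuousLinearMap

theorem multiplier_apply {g : Eu d → ℂ} (hg : MemLp g ∞ volume) (φ : L2 d) :
    multiplier g hg φ = (fourierL2 d).symm (bddMul g hg (fourierL2 d φ)) := rfl

theorem norm_multiplier_sub_le {g h : Eu d → ℂ} (hg : MemLp g ∞ volume) (hh : MemLp h ∞ volume)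
    {C : ℝ} (hC : 0 ≤ C) (hgh : ∀ x, ‖g x - h x‖ ≤ C) :
    ‖multiplier g hg - multiplier h hh‖ ≤ C := by
  refine ContinuousLinearMap.opNorm_le_bound _ hC fun φ => ?_
  rw [sub_apply, multiplier_apply, multiplier_apply, ← map_sub, ← sub_apply, bddMul_sub,
    LinearIsometryEquiv.norm_map]
  refine (ContinuousLinearMap.le_of_opNorm_le _
    (norm_bddMul_le _ hC (Eventually.of_forall hgh)) _).trans_eq ?_
  rw [LinearIsometryEquiv.norm_map]

theorem multiplier_comm {g h : Eu d → ℂ} (hg : MemLp g ∞ volume) (hh : MemLp h ∞ volume) :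
    multiplier g hg * multiplier h hh = multiplier h hh * multiplier g hg := by
  ext1 φ
  rw [mul_apply_eq_comp, mul_apply_eq_comp]
  simp only [multiplier_apply, LinearIsometryEquiv.apply_symm_apply]
  rw [← mul_apply_eq_comp, bddMul_comm hg hh, mul_apply_eq_comp]

/-- The character `ξ ↦ exp(2πi v·ξ)`. -/
noncomputable def phase (v : Eu d) (ξ : Eu d) : ℂ := (Real.fourierChar (inner ℝ v ξ) : ℂ)

theorem continuous_phase (v : Eu d) : Continuous (phase v) := by
  unfold phase
  fun_prop

theorem norm_phase (v ξ : Eu d) : ‖phase v ξ‖ = 1 := Circle.norm_coe _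

theorem memLp_phase (v : Eu d) : MemLp (phase v) ∞ volume :=
  memLp_top_of_bound (continuous_phase v).aestronglyMeasurable 1
    (Eventually.of_forall fun ξ => (norm_phase v ξ).le)

theorem translate_toLp (v : Eu d) (f : SchwartzMap (Eu d) ℂ) :
    translate v (f.toLp 2 volume) =
      (SchwartzMap.compSubConstCLM ℂ (-v) f).toLp 2 (volume : Measure (Eu d)) := by
  apply Lp.ext
  filter_upwards [translate_coeFn v (f.toLp 2 volume),
    (measurePreserving_add_right volume v).quasiMeasurePreserving.ae_eq_comp
      (f.coeFn_toLp 2 (volume : Measure (Eu d))),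
    (SchwartzMap.compSubConstCLM ℂ (-v) f).coeFn_toLp 2 (volume : Measure (Eu d))] with x h1 h2 h3
  rw [h1, h3, SchwartzMap.compSubConstCLM_apply, sub_neg_eq_add]
  exact h2

theorem fourier_comp_add (v ξ : Eu d) (f : SchwartzMap (Eu d) ℂ) :
    𝓕 (SchwartzMap.compSubConstCLM ℂ (-v) f) ξ = phase v ξ * 𝓕 f ξ := by
  have := congrFun (VectorFourier.fourierIntegral_comp_add_right Real.fourierChar volume
    (innerₗ (Eu d)) f v) ξ
  have e : ((SchwartzMap.compSubConstCLM ℂ (-v) f : SchwartzMap (Eu d) ℂ) : Eu d → ℂ) =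
      f ∘ fun x => x + v := by
    ext x
    rw [SchwartzMap.compSubConstCLM_apply, sub_neg_eq_add]
    rfl
  rw [SchwartzMap.fourier_coe, SchwartzMap.fourier_coe, e]
  exact this

theorem fourierL2_toLp (f : SchwartzMap (Eu d) ℂ) :
    fourierL2 d (f.toLp 2 volume) = (𝓕 f).toLp 2 volume :=
  SchwartzMap.toLp_fourier_eq f

theorem fourierL2_translate_toLp (v : Eu d) (f : SchwartzMap (Eu d) ℂ) :
    fourierL2 d (translate v (f.toLp 2 volume)) =
      bddMul (phase v) (memLp_phase v) (fourierL2 d (f.toLp 2 volume)) := by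
  rw [translate_toLp, fourierL2_toLp, fourierL2_toLp]
  apply Lp.ext
  filter_upwards [bddMul_coeFn (memLp_phase v) ((𝓕 f).toLp 2 volume),
    (𝓕 f).coeFn_toLp 2 (volume : Measure (Eu d)),
    (𝓕 (SchwartzMap.compSubConstCLM ℂ (-v) f)).coeFn_toLp 2 (volume : Measure (Eu d))]
    with x h1 h2 h3
  rw [h1, h2, h3, fourier_comp_add]

/-- Both sides are continuous and agree on the dense image of Schwartz space. This makes
translations commute with `R₀` and turns multipliers into averages of translations. -/
theorem translate_eq_multiplier (v : Eu d) : translate v = multiplier (phase v) (memLp_phase v) := by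
  ext1 φ
  rw [multiplier_apply, LinearIsometryEquiv.eq_symm_apply]
  have hd : DenseRange (SchwartzMap.toLpCLM ℂ (E := Eu d) ℂ 2 volume) :=
    SchwartzMap.denseRange_toLpCLM ENNReal.ofNat_ne_top
  have h1 : Continuous fun φ => fourierL2 d (translate v φ) :=
    (fourierL2 d).continuous.comp (translate v).continuous
  have h2 : Continuous fun φ => bddMul (phase v) (memLp_phase v) (fourierL2 d φ) :=
    (bddMul _ _).continuous.comp (fourierL2 d).continuous
  exact congrFun (hd.equalizer h1 h2 (funext fun f => fourierL2_translate_toLp v f)) φ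

theorem inner_multiplier {g : Eu d → ℂ} (hg : MemLp g ∞ volume) (ψ φ : L2 d) :
    inner ℂ ψ (multiplier g hg φ) =
      ∫ ξ, g ξ * (starRingEnd ℂ (fourierL2 d ψ ξ) * fourierL2 d φ ξ) := by
  rw [multiplier_apply, ← LinearIsometryEquiv.inner_map_map (fourierL2 d),
    LinearIsometryEquiv.apply_symm_apply, L2.inner_def]
  apply integral_congr_ae
  filter_upwards [bddMul_coeFn hg (fourierL2 d φ)] with ξ hξ
  rw [hξ, RCLike.inner_apply]
  ring

theorem memLp_fourier {f : Eu d → ℂ} (hf : Integrable f) : MemLp (𝓕 f) ∞ volume :=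
  memLp_top_of_bound (VectorFourier.fourierIntegral_continuous Real.continuous_fourierChar (L := innerₗ (Eu d))
    continuous_inner hf).aestronglyMeasurable (∫ x, ‖f x‖)
    (Eventually.of_forall fun _ =>
      VectorFourier.norm_fourierIntegral_le_integral_norm _ _ _ _ _)

/-- A Fourier multiplier whose symbol is the Fourier transform of `f ∈ L¹` is the convolution
with `f`, in the weak sense. -/
theorem inner_multiplier_fourier {f : Eu d → ℂ} (hf : Integrable f) (ψ φ : L2 d) :
    inner ℂ ψ (multiplier (𝓕 f) (memLp_fourier hf) φ) =
      ∫ y, f y * inner ℂ ψ (translate (-y) φ) := by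
  set G : Eu d → ℂ := fun ξ => starRingEnd ℂ (fourierL2 d ψ ξ) * fourierL2 d φ ξ with hG
  have hGi : Integrable G := by
    refine (L2.integrable_inner (𝕜 := ℂ) (fourierL2 d ψ) (fourierL2 d φ)).congr
      (Eventually.of_forall fun ξ => (RCLike.inner_apply _ _).trans (mul_comm _ _))
  -- Fubini applies: `G` is a product of two `L²` functions, `f` is integrable and the phase has
  -- modulus one.
  have hint : Integrable (Function.uncurry fun ξ y => phase (-y) ξ * (G ξ * f y))
      (volume.prod volume) := by
    refine (hGi.mul_prod hf).bdd_mul (c := 1) ?_ (Eventually.of_forall fun p => (norm_phase _ _).le)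
    apply Continuous.aestronglyMeasurable
    unfold phase
    fun_prop
  rw [inner_multiplier]
  calc ∫ ξ, 𝓕 f ξ * G ξ = ∫ ξ, ∫ y, phase (-y) ξ * (G ξ * f y) := by
        congr 1 with ξ
        rw [Real.fourier_eq, ← integral_mul_const]
        congr 1 with y
        rw [Circle.smul_def, smul_eq_mul, phase, inner_neg_left]
        ring
    _ = ∫ y, ∫ ξ, phase (-y) ξ * (G ξ * f y) := integral_integral_swap hint
    _ = _ := by
        congr 1 with y
        rw [translate_eq_multiplier, inner_multiplier, ← integral_const_mul]
        congr 1 with ξ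
        ring

/-- The operator is a superposition of translations by vectors of length at most `m`, each of which
moves supports by at most `m`. -/
theorem multiplier_fourier_mem_finProp {f : Eu d → ℂ} (hf : Integrable f) {m : ℕ}
    (hm : ∀ y, (m : ℝ) < ‖y‖ → f y = 0) :
    multiplier (𝓕 f) (memLp_fourier hf) ∈ finProp d m := by
  intro a b r s hr hs hne
  by_contra hcon
  apply hne
  rw [not_le] at hcon
  ext1 φ
  refine ext_inner_left ℂ fun ψ => ?_
  rw [mul_apply_eq_comp, mul_apply_eq_comp, zero_apply, inner_zero_right,
    ← ContinuousLinearMap.adjoint_inner_left, ← ContinuousLinearMap.star_eq_adjoint, star_proj,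
    inner_multiplier_fourier hf]
  refine integral_eq_zero_of_ae (Eventually.of_forall fun y => ?_)
  by_cases hy : (m : ℝ) < ‖y‖
  · simp [hm y hy]
  rw [Pi.zero_apply, mul_eq_zero]
  right
  rw [L2.inner_def]
  refine integral_eq_zero_of_ae ?_
  filter_upwards [proj_coeFn (ball a r) measurableSet_ball ψ,
    translate_coeFn (-y) (proj (ball b s) measurableSet_ball φ),
    (measurePreserving_add_right volume (-y)).quasiMeasurePreserving.ae_eq_comp
      (proj_coeFn (ball b s) measurableSet_ball φ)] with x h1 h2 h3
  simp only [Function.comp_apply] at h3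
  rw [h1, h2, h3]
  by_cases hx : x ∈ ball a r
  · have : x + -y ∉ ball b s := by
      intro hx'
      rw [mem_ball] at hx hx'
      have t1 := dist_triangle a x b
      have t2 := dist_triangle x (x + -y) b
      rw [dist_comm] at hx
      have t3 : dist x (x + -y) = ‖y‖ := by simp [dist_eq_norm]
      linarith
    simp [this]
  · simp [hx]

theorem mem_stdAlgebra_of_tendsto {A : L2 d →L[ℂ] L2 d} {B : ℕ → L2 d →L[ℂ] L2 d} {ε : ℕ → ℝ}
    (hε : Tendsto ε atTop (𝓝 0)) (hB : ∀ n, B n ∈ stdAlgebra d) (h : ∀ n, ‖B n - A‖ ≤ ε n) :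
    A ∈ stdAlgebra d := by
  have hc : IsClosed (stdAlgebra d : Set (L2 d →L[ℂ] L2 d)) := inferInstance
  refine hc.mem_of_tendsto (tendsto_iff_norm_sub_tendsto_zero.2
    (squeeze_zero (fun _ => norm_nonneg _) h hε)) (Eventually.of_forall hB)

/-- Truncating the convolution kernel to a ball gives finite propagation. The error in operator norm
is the sup norm of the symbol error, hence at most the `L¹` norm of the discarded tail. -/
theorem multiplier_schwartz_mem_stdAlgebra (g : SchwartzMap (Eu d) ℂ) (hg : MemLp g ∞ volume) :
    multiplier g hg ∈ stdAlgebra d := by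
  set f : SchwartzMap (Eu d) ℂ := 𝓕⁻ g with hf
  have hfg : (g : Eu d → ℂ) = 𝓕 (f : Eu d → ℂ) := by
    rw [← SchwartzMap.fourier_coe, hf, FourierTransform.fourier_fourierInv_eq]
  let F : ℕ → Eu d → ℂ := fun n => (closedBall 0 (n : ℝ)).indicator f
  have hF : ∀ n, Integrable (F n) := fun n => f.integrable.indicator measurableSet_closedBall
  have hlim : Tendsto (fun n => ∫ x, ‖F n x - f x‖) atTop (𝓝 0) := by
    have := tendsto_integral_of_dominated_convergence (μ := (volume : Measure (Eu d)))
      (F := fun n x => ‖F n x - f x‖) (f := fun _ => (0 : ℝ)) (fun x => ‖f x‖)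
      (fun n => ((hF n).sub f.integrable).norm.aestronglyMeasurable) f.integrable.norm
      (fun n => Eventually.of_forall fun x => ?_) (Eventually.of_forall fun x => ?_)
    · simpa using this
    · by_cases hx : x ∈ closedBall (0 : Eu d) n
      · simp [F, hx]
      · simp only [F, indicator_of_notMem hx]
        simp
    · refine tendsto_const_nhds.congr' ?_
      filter_upwards [eventually_ge_atTop ⌈‖x‖⌉₊] with n hn
      have hx : x ∈ closedBall (0 : Eu d) n := by
        rw [mem_closedBall_zero_iff]
        exact Nat.ceil_le.1 hn
      simp [F, indicator_of_mem hx]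
  refine mem_stdAlgebra_of_tendsto (B := fun n => multiplier (𝓕 (F n)) (memLp_fourier (hF n)))
    hlim (fun n => finProp_subset_stdAlgebra (multiplier_fourier_mem_finProp (hF n) (m := n) ?_))
    fun n => norm_multiplier_sub_le _ _ (integral_nonneg fun _ => norm_nonneg _) fun ξ => ?_
  · intro y hy
    apply indicator_of_notMem
    rw [mem_closedBall_zero_iff]
    exact hy.not_ge
  · rw [hfg]
    have : 𝓕 (F n) ξ - 𝓕 (f : Eu d → ℂ) ξ = 𝓕 (F n - f) ξ := by
      simp only [Real.fourier_eq, Pi.sub_apply, smul_sub]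
      rw [integral_sub]
      · exact (Real.fourierIntegral_convergent_iff ξ).2 (hF n)
      · exact (Real.fourierIntegral_convergent_iff ξ).2 f.integrable
    rw [this]
    exact VectorFourier.norm_fourierIntegral_le_integral_norm _ _ _ _ _

/-! ### The free resolvent -/

theorem mulOp_coeFn (V : Eu d → ℂ) (φ : (mulOp V).domain) :
    (mulOp V φ : Eu d → ℂ) =ᵐ[volume] fun x => V x * (φ : L2 d) x :=
  MemLp.coeFn_toLp (f := fun x => V x * (φ : L2 d) x) φ.2

/-- The symbol `ξ ↦ (a + 4π²|ξ|²)⁻¹` of the free resolvent. -/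
noncomputable def freeSymbol (d : ℕ) (a : ℝ) (ξ : Eu d) : ℂ :=
  ((a + 4 * Real.pi ^ 2 * ‖ξ‖ ^ 2 : ℝ)⁻¹ : ℝ)

theorem freeSymbol_denom_pos {a : ℝ} (ha : 0 < a) (ξ : Eu d) :
    0 < a + 4 * Real.pi ^ 2 * ‖ξ‖ ^ 2 := by positivity

theorem contDiff_freeSymbol {a : ℝ} (ha : 0 < a) : ContDiff ℝ (⊤ : ℕ∞) (freeSymbol d a) := by
  refine Complex.ofRealCLM.contDiff.comp (ContDiff.inv ?_ fun ξ => (freeSymbol_denom_pos ha ξ).ne')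
  exact contDiff_const.add (contDiff_const.mul (contDiff_norm_sq ℝ))

theorem norm_freeSymbol {a : ℝ} (ha : 0 < a) (ξ : Eu d) :
    ‖freeSymbol d a ξ‖ = (a + 4 * Real.pi ^ 2 * ‖ξ‖ ^ 2)⁻¹ := by
  rw [freeSymbol, Complex.norm_real, Real.norm_of_nonneg (inv_pos.2 (freeSymbol_denom_pos ha ξ)).le]

theorem memLp_freeSymbol {a : ℝ} (ha : 0 < a) : MemLp (freeSymbol d a) ∞ volume := by
  refine memLp_top_of_bound (contDiff_freeSymbol ha).continuous.aestronglyMeasurable a⁻¹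
    (Eventually.of_forall fun ξ => ?_)
  rw [norm_freeSymbol ha]
  gcongr
  have : 0 ≤ 4 * Real.pi ^ 2 * ‖ξ‖ ^ 2 := by positivity
  linarith

/-- The symbol is smooth and vanishes at infinity, so smooth cutoffs of it are Schwartz functions
converging to it uniformly. -/
theorem multiplier_freeSymbol_mem_stdAlgebra {a : ℝ} (ha : 0 < a) :
    multiplier (freeSymbol d a) (memLp_freeSymbol ha) ∈ stdAlgebra d := by
  let χ : ∀ n : ℕ, ContDiffBump (0 : Eu d) := fun n =>
    ⟨n + 1, n + 2, by positivity, by linarith⟩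
  have hs : ∀ n, HasCompactSupport fun ξ => (χ n ξ : ℂ) * freeSymbol d a ξ := fun n =>
    ((χ n).hasCompactSupport.comp_left (g := fun t : ℝ => (t : ℂ)) rfl).mul_right
  have hd : ∀ n, ContDiff ℝ (⊤ : ℕ∞) fun ξ => (χ n ξ : ℂ) * freeSymbol d a ξ := fun n =>
    (Complex.ofRealCLM.contDiff.comp (χ n).contDiff).mul (contDiff_freeSymbol ha)
  let g : ℕ → SchwartzMap (Eu d) ℂ := fun n => (hs n).toSchwartzMap (hd n)
  have hg : ∀ n, MemLp (g n) ∞ volume := fun n => (g n).memLp_top volume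
  refine mem_stdAlgebra_of_tendsto (B := fun n => multiplier (g n) (hg n))
    tendsto_one_div_add_atTop_nhds_zero_nat
    (fun n => multiplier_schwartz_mem_stdAlgebra _ _)
    fun n => norm_multiplier_sub_le _ _ (by positivity) fun ξ => ?_
  have e : g n ξ - freeSymbol d a ξ = ((χ n ξ - 1 : ℝ) : ℂ) * freeSymbol d a ξ := by
    change (χ n ξ : ℂ) * freeSymbol d a ξ - freeSymbol d a ξ = _
    push_cast
    ring
  rw [e, norm_mul, Complex.norm_real, norm_freeSymbol ha]
  have hn : (1 : ℝ) ≤ (n : ℝ) + 1 := by linarith [n.cast_nonneg (α := ℝ)]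
  -- The cutoff changes nothing inside this ball; outside it the symbol is at most `1/(n+1)`,
  -- because `4π² ≥ 1` and `‖ξ‖² ≥ n + 1`.
  by_cases hξ : ξ ∈ closedBall (0 : Eu d) (n + 1)
  · rw [(χ n).one_of_mem_closedBall hξ, sub_self, norm_zero, zero_mul]
    positivity
  · rw [mem_closedBall_zero_iff, not_le] at hξ
    have h1 : ‖χ n ξ - 1‖ ≤ 1 := by
      rw [Real.norm_eq_abs, abs_le]
      constructor <;> linarith [(χ n).nonneg (x := ξ), (χ n).le_one (x := ξ)]
    refine (mul_le_of_le_one_left (inv_pos.2 (freeSymbol_denom_pos ha ξ)).le h1).trans ?_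
    rw [one_div]
    apply inv_anti₀ (by positivity)
    have h2 : (n : ℝ) + 1 ≤ ‖ξ‖ ^ 2 := by nlinarith
    have h3 : (1 : ℝ) ≤ 4 * Real.pi ^ 2 := by nlinarith [Real.pi_gt_three]
    nlinarith [sq_nonneg ‖ξ‖]

/-- On the Fourier side `-a - H₀` is multiplication by `-(a + p)`, whence the minus sign. -/
theorem isResolventAt_negLaplacian {a : ℝ} (ha : 0 < a) :
    IsResolventAt (negLaplacian d) (-(a : ℂ))
      (-multiplier (freeSymbol d a) (memLp_freeSymbol ha)) := by
  set p : Eu d → ℂ := fun ξ => ((4 * Real.pi ^ 2 * ‖ξ‖ ^ 2 : ℝ) : ℂ) with hp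
  have hinv : ∀ ξ, ((a : ℂ) + p ξ) * freeSymbol d a ξ = 1 := by
    intro ξ
    rw [hp, freeSymbol, ← Complex.ofReal_add, ← Complex.ofReal_mul,
      mul_inv_cancel₀ (freeSymbol_denom_pos ha ξ).ne', Complex.ofReal_one]
  set B := bddMul (freeSymbol d a) (memLp_freeSymbol ha) with hB
  have hBp : ∀ ψ : L2 d, (fun ξ => p ξ * (-B ψ) ξ) =ᵐ[volume] (((a : ℂ) • B ψ - ψ : L2 d)) := by
    intro ψ
    filter_upwards [bddMul_coeFn (memLp_freeSymbol ha) ψ, Lp.coeFn_neg (B ψ),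
      Lp.coeFn_sub ((a : ℂ) • B ψ) ψ, Lp.coeFn_smul (a : ℂ) (B ψ)] with ξ h1 h2 h3 h4
    rw [h2, h3, Pi.sub_apply, h4, Pi.smul_apply, Pi.neg_apply, h1, smul_eq_mul]
    linear_combination (-(ψ ξ)) * hinv ξ
  have hdom : ∀ ψ : L2 d, -B ψ ∈ (mulOp p).domain := fun ψ =>
    (memLp_congr_ae (hBp ψ)).2 (Lp.memLp _)
  have hval : ∀ ψ : L2 d, mulOp p ⟨-B ψ, hdom ψ⟩ = (a : ℂ) • B ψ - ψ := fun ψ =>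
    Lp.ext ((mulOp_coeFn p _).trans (hBp ψ))
  refine isResolventAt_of_exists (fun φ => ?_) fun ψ => ?_
  · have hF : fourierL2 d (-multiplier (freeSymbol d a) (memLp_freeSymbol ha) φ) =
        -B (fourierL2 d φ) := by
      rw [map_neg, multiplier_apply, LinearIsometryEquiv.apply_symm_apply]
    have hmem : -multiplier (freeSymbol d a) (memLp_freeSymbol ha) φ ∈ (negLaplacian d).domain := by
      change fourierL2 d _ ∈ (mulOp p).domain
      rw [hF]
      exact hdom _
    obtain ⟨y, hy⟩ : ∃ y : (negLaplacian d).domain,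
        (y : L2 d) = -multiplier (freeSymbol d a) (memLp_freeSymbol ha) φ := ⟨⟨_, hmem⟩, rfl⟩
    refine ⟨y, hy, ?_⟩
    rw [← hy] at hF
    have hAy : fourierL2 d (negLaplacian d y) = (a : ℂ) • B (fourierL2 d φ) - fourierL2 d φ := by
      rw [← hval]
      refine ((fourierL2 d).apply_symm_apply _).trans ?_
      exact congrArg (mulOp p) (Subtype.ext hF)
    apply (fourierL2 d).injective
    rw [map_sub, map_smul, hF, hAy]
    module
  · obtain ⟨ψ, hψ⟩ := ψ
    let χ : (mulOp p).domain := ⟨fourierL2 d ψ, hψ⟩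
    have e : negLaplacian d ⟨ψ, hψ⟩ = (fourierL2 d).symm (mulOp p χ) := rfl
    apply (fourierL2 d).injective
    rw [e, neg_apply, map_neg, multiplier_apply, LinearIsometryEquiv.apply_symm_apply, map_sub,
      map_smul, LinearIsometryEquiv.apply_symm_apply]
    apply Lp.ext
    have hχ : (mulOp p χ : Eu d → ℂ) =ᵐ[volume] fun ξ => p ξ * (χ : L2 d) ξ :=
      mulOp_coeFn p χ
    set η : L2 d := -(a : ℂ) • fourierL2 d ψ - mulOp p χ with hη
    filter_upwards [hχ, bddMul_coeFn (memLp_freeSymbol ha) η, Lp.coeFn_neg (B η),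
      Lp.coeFn_sub (-(a : ℂ) • fourierL2 d ψ) (mulOp p χ),
      Lp.coeFn_smul (-(a : ℂ)) (fourierL2 d ψ)] with ξ h1 h2 h3 h4 h5
    rw [h3, Pi.neg_apply, h2, h4, Pi.sub_apply, h5, h1, Pi.smul_apply, smul_eq_mul]
    change -(freeSymbol d a ξ * (-(a : ℂ) * fourierL2 d ψ ξ - p ξ * fourierL2 d ψ ξ)) = _
    linear_combination (fourierL2 d ψ ξ) * hinv ξ

theorem freeResolvent_eq {a : ℝ} (ha : 0 < a) :
    freeResolvent d a = multiplier (freeSymbol d a) (memLp_freeSymbol ha) := by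
  rw [freeResolvent, (isResolventAt_negLaplacian ha).resolvent_eq, neg_neg]

theorem isResolventAt_freeResolvent {a : ℝ} (ha : 0 < a) :
    IsResolventAt (negLaplacian d) (-(a : ℂ)) (-freeResolvent d a) := by
  rw [freeResolvent_eq ha]
  exact isResolventAt_negLaplacian ha

theorem freeResolvent_mem_stdAlgebra {a : ℝ} (ha : 0 < a) :
    freeResolvent d a ∈ stdAlgebra d := by
  rw [freeResolvent_eq ha]
  exact multiplier_freeSymbol_mem_stdAlgebra ha

theorem translate_freeResolvent {a : ℝ} (ha : 0 < a) (v : Eu d) :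
    Commute (translate v) (freeResolvent d a) := by
  rw [freeResolvent_eq ha, translate_eq_multiplier]
  exact multiplier_comm _ _

/-! ### Relatively bounded perturbations -/

/-- Here the approximation of `V` by bounded potentials enters: `V A` is a norm limit of products `U
A`, with both factors in `𝒜`. -/
theorem relMul_mem_stdAlgebra {A : L2 d →L[ℂ] L2 d} (hA : A ∈ stdAlgebra d) {V : Eu d → ℂ}
    (hV : V ∈ potentials A) : relMul A V hV.1 hV.2.1 ∈ stdAlgebra d := by
  have hε : ∀ n : ℕ, 0 < ENNReal.ofReal (1 / (n + 1)) := fun n =>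
    ENNReal.ofReal_pos.2 (by positivity)
  choose U hU hVU using fun n : ℕ => hV.2.2 _ (hε n)
  refine mem_stdAlgebra_of_tendsto (B := fun n => bddMul (U n) (hU n) * A)
    tendsto_one_div_add_atTop_nhds_zero_nat
    (fun n => mul_mem (bddMul_mem_stdAlgebra _) hA) fun n => ?_
  rw [norm_sub_rev]
  refine (norm_le_relNorm (A := A) (V := V - U n) (fun φ => ?_) ((hVU n).trans_le le_top)).trans
    (ENNReal.toReal_le_of_le_ofReal (by positivity) (hVU n).le)
  rw [sub_apply]
  filter_upwards [relMul_coeFn A V hV.1 hV.2.1 φ, bddMul_coeFn (hU n) (A φ),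
    Lp.coeFn_sub (relMul A V hV.1 hV.2.1 φ) (bddMul (U n) (hU n) (A φ))] with x h1 h2 h3
  rw [mul_apply_eq_comp, h3, Pi.sub_apply, h1, h2, Pi.sub_apply, sub_mul]

theorem isUnit_one_add_relMul {A : L2 d →L[ℂ] L2 d} {V : Eu d → ℂ}
    (hm : AEStronglyMeasurable V volume) (hb : relNorm A V < ∞) (h1 : relNorm A V < 1) :
    IsUnit (1 + relMul A V hm hb) := by
  rw [← sub_neg_eq_add]
  apply isUnit_one_sub_of_norm_lt_one
  rw [norm_neg]
  refine (norm_le_relNorm (relMul_coeFn A V hm hb) hb).trans_lt ?_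
  exact (ENNReal.toReal_lt_toReal hb.ne ENNReal.one_ne_top).2 h1

/-- With `-R = (z - H₀)⁻¹` one has `z - H₀ - V = (1 + V R)(z - H₀)`. -/
theorem isResolventAt_schrodinger {V : Eu d → ℂ} {z : ℂ} {R : L2 d →L[ℂ] L2 d}
    (hR : IsResolventAt (negLaplacian d) z (-R)) (hm : AEStronglyMeasurable V volume)
    (hb : relNorm R V < ∞) {u : (L2 d →L[ℂ] L2 d)ˣ} (hu : u.val = 1 + relMul R V hm hb) :
    IsResolventAt (schrodinger V) z (-(R * u⁻¹.val)) := by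
  have h1 : ∀ φ, u⁻¹.val φ + relMul R V hm hb (u⁻¹.val φ) = φ := by
    intro φ
    have := congrArg (fun T : L2 d →L[ℂ] L2 d => T φ) u.mul_inv
    rw [hu] at this
    simpa using this
  have h2 : ∀ φ, u⁻¹.val (φ + relMul R V hm hb φ) = φ := by
    intro φ
    have := congrArg (fun T : L2 d →L[ℂ] L2 d => T φ) u.inv_mul
    rw [hu] at this
    simpa using this
  -- Every vector of `Dom(H₀)` has this form, so `Dom(H₀) ⊆ Dom(V)` and the sum has domain
  -- `Dom(H₀)`.
  have key : ∀ (y : (negLaplacian d).domain) (ψ : L2 d), (y : L2 d) = -R ψ →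
      ∃ h : (y : L2 d) ∈ (mulOp V).domain, mulOp V ⟨y, h⟩ = -relMul R V hm hb ψ := by
    intro y ψ hy
    have hy' : (y : L2 d) = R (-ψ) := by rw [hy, map_neg]
    have hmem : R (-ψ) ∈ (mulOp V).domain := memLp_of_relNorm_lt_top hm hb (-ψ)
    refine ⟨hy' ▸ hmem, ?_⟩
    rw [← map_neg]
    exact (congrArg (mulOp V) (Subtype.ext hy' : (⟨y, hy' ▸ hmem⟩ : (mulOp V).domain) =
      ⟨R (-ψ), hmem⟩))
  refine isResolventAt_of_exists (fun φ => ?_) fun ψ => ?_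
  · obtain ⟨y, hy, e⟩ := hR.exists_dom (u⁻¹.val φ)
    obtain ⟨h, e'⟩ := key y _ hy
    refine ⟨⟨y, y.2, h⟩, hy, ?_⟩
    have : schrodinger V ⟨y, y.2, h⟩ = negLaplacian d y + mulOp V ⟨y, h⟩ := rfl
    rw [this, e']
    conv_rhs => rw [← h1 φ]
    rw [← sub_sub, sub_neg_eq_add, e]
  · obtain ⟨ψ, hψ, h⟩ := ψ
    have hψ' := hR.2 ⟨ψ, hψ⟩
    set χ := z • ψ - negLaplacian d ⟨ψ, hψ⟩ with hχ
    obtain ⟨h', e'⟩ := key ⟨ψ, hψ⟩ χ hψ'.symm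
    have : schrodinger V ⟨ψ, hψ, h⟩ = negLaplacian d ⟨ψ, hψ⟩ + mulOp V ⟨ψ, h'⟩ := rfl
    rw [this, e', ← sub_sub, sub_neg_eq_add]
    change -R (u⁻¹.val (χ + relMul R V hm hb χ)) = ψ
    rw [h2]
    exact hψ'

/-- Spectral permanence for closed ⋆-subalgebras of a C⋆-algebra. -/
theorem inv_mem_stdAlgebra {u : (L2 d →L[ℂ] L2 d)ˣ} (hu : u.val ∈ stdAlgebra d) :
    u⁻¹.val ∈ stdAlgebra d := by
  obtain ⟨w, hw⟩ := ((stdAlgebra d).coe_isUnit (a := ⟨u, hu⟩)).1 u.isUnit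
  have h := congrArg (Subtype.val) w.mul_inv
  rw [hw] at h
  have : u⁻¹.val = ((w⁻¹ : (stdAlgebra d)ˣ) : stdAlgebra d) :=
    left_inv_eq_right_inv u.inv_mul h
  rw [this]
  exact Subtype.mem _

/-- Confinement on one side suffices: if `B` has finite propagation and approximates `A`, then `P B`
is automatically confined on the right to a larger neighbourhood of `S`. -/
theorem mem_idealOf_of_nbhdProj_mul {S : Set (Eu d)} {n : ℕ} {A : stdAlgebra d}
    (h : nbhdProj S n * (A : L2 d →L[ℂ] L2 d) = A) : A ∈ idealOf S := by
  let P : stdAlgebra d := ⟨nbhdProj S n, proj_mem_stdAlgebra isOpen_thickening.measurableSet⟩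
  have hPA : P * A = A := Subtype.ext h
  change A ∈ closure (confinedUnion S)
  rw [← hPA]
  refine map_mem_closure (f := fun B => P * B) (continuous_const.mul continuous_id)
    (dense_finProp A) fun B hB => ?_
  obtain ⟨m, hm⟩ := mem_iUnion.1 hB
  refine mem_confinedUnion.2 ⟨m + n + 1, confined_iff.2 ⟨?_, finProp_nbhdProj hm⟩⟩
  change _ * (nbhdProj S n * (B : L2 d →L[ℂ] L2 d)) = nbhdProj S n * (B : L2 d →L[ℂ] L2 d)
  rw [← mul_assoc, nbhdProj_mul_of_le S (by push_cast; linarith [m.cast_nonneg (α := ℝ)])]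

theorem specAt_eq {S : Set (Eu d)} {A : L2 d →ₗ.[ℂ] L2 d} {α : ℂ} (hα : α ∈ resolventSet A)
    (hA : resolvent A α ∈ stdAlgebra d) :
    specAt S A = {z | ¬ IsUnit (Ideal.Quotient.mk (idealOf S)
      (1 + (z - α) • (⟨resolvent A α, hA⟩ : stdAlgebra d)))} := by
  rw [specAt, pseudoSpectrum_eq _
    (⟨α, hα, hA⟩ : {α | α ∈ resolventSet A ∧ resolvent A α ∈ stdAlgebra d})]
  · rfl
  · intro β γ
    have : (⟨resolvent A β, β.2.2⟩ : stdAlgebra d) - ⟨resolvent A γ, γ.2.2⟩ =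
        ((γ : ℂ) - β) • (⟨resolvent A β, β.2.2⟩ * ⟨resolvent A γ, γ.2.2⟩) :=
      Subtype.ext (resolvent_sub_resolvent β.2.1 γ.2.1)
    exact congrArg (Ideal.Quotient.mk (idealOf S)) this

/-! ### Invertibility modulo the ideals -/

theorem norm_proj_le (S : Set (Eu d)) (hS : MeasurableSet S) : ‖proj S hS‖ ≤ 1 :=
  ContinuousLinearMap.opNorm_le_bound _ zero_le_one (norm_projLin_le S hS)

theorem one_sub_proj (S : Set (Eu d)) (hS : MeasurableSet S) :
    1 - proj S hS = proj Sᶜ hS.compl := by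
  rw [← proj_add_compl S hS, add_sub_cancel_left]

/-- Dominated convergence for `|φ|²`. -/
theorem tendsto_proj {E : ℕ → Set (Eu d)} (hE : ∀ n, MeasurableSet (E n))
    (h : ∀ x, ∀ᶠ n in atTop, x ∉ E n) (φ : L2 d) :
    Tendsto (fun n => proj (E n) (hE n) φ) atTop (𝓝 0) := by
  have hi := L2.integrable_inner (𝕜 := ℂ) φ φ
  have e : ∀ n, inner ℂ (proj (E n) (hE n) φ) (proj (E n) (hE n) φ) =
      ∫ x, (E n).indicator (fun x => inner ℂ (φ x) (φ x)) x := by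
    intro n
    rw [L2.inner_def]
    apply integral_congr_ae
    filter_upwards [proj_coeFn (E n) (hE n) φ] with x hx
    rw [hx]
    by_cases hxE : x ∈ E n
    · simp only [indicator_of_mem hxE]
    · simp only [indicator_of_notMem hxE, inner_zero_left]
  have hlim := tendsto_integral_of_dominated_convergence (μ := (volume : Measure (Eu d)))
    (F := fun n => (E n).indicator (fun x => inner ℂ (φ x) (φ x))) (f := fun _ => (0 : ℂ))
    (fun x => ‖inner ℂ (φ x) (φ x)‖) (fun n => (hi.indicator (hE n)).aestronglyMeasurable)
    hi.norm (fun n => Eventually.of_forall fun x => norm_indicator_le_norm_self _ _)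
    (Eventually.of_forall fun x => tendsto_const_nhds.congr' <| by
      filter_upwards [h x] with n hn
      rw [indicator_of_notMem hn])
  simp only [← e, integral_zero] at hlim
  have h2 := hlim.norm.sqrt
  simp only [norm_zero, Real.sqrt_zero, inner_self_eq_norm_sq_to_K, norm_pow] at h2
  rw [tendsto_zero_iff_norm_tendsto_zero]
  refine h2.congr fun n => ?_
  rw [Real.sqrt_sq (norm_nonneg _)]
  exact (RCLike.norm_ofReal _).trans (abs_norm _)

/-- A confined operator within `1/4` of `k` is annihilated on both sides by `1 - P_{S(n)}`, so only
the approximation error remains. -/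
theorem exists_nbhdProj_of_mem_idealOf {S : Set (Eu d)} {k : stdAlgebra d} (hk : k ∈ idealOf S) :
    ∃ n : ℕ, ‖(k : L2 d →L[ℂ] L2 d) * (1 - nbhdProj S n)‖ < 1 / 4 ∧
      ‖(1 - nbhdProj S n) * (k : L2 d →L[ℂ] L2 d)‖ < 1 / 4 := by
  obtain ⟨k', hk', hd⟩ := Metric.mem_closure_iff.1 hk (1 / 4) (by norm_num)
  obtain ⟨n, hn⟩ := mem_confinedUnion.1 hk'
  rw [confined_iff] at hn
  have hd' : ‖(k : L2 d →L[ℂ] L2 d) - k'‖ < 1 / 4 := by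
    rw [← dist_eq_norm]
    exact hd
  have hP : ‖1 - nbhdProj S n‖ ≤ 1 := by
    rw [nbhdProj, one_sub_proj]
    exact norm_proj_le _ _
  refine ⟨n, ?_, ?_⟩
  · have : (k : L2 d →L[ℂ] L2 d) * (1 - nbhdProj S n) = (k - k') * (1 - nbhdProj S n) := by
      rw [sub_mul, mul_sub (k' : L2 d →L[ℂ] L2 d), hn.2, mul_one, sub_self, sub_zero]
    rw [this]
    exact ((norm_mul_le _ _).trans (mul_le_of_le_one_right (norm_nonneg _) hP)).trans_lt hd'
  · have : (1 - nbhdProj S n) * (k : L2 d →L[ℂ] L2 d) = (1 - nbhdProj S n) * (k - k') := by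
      rw [mul_sub, sub_mul _ _ (k' : L2 d →L[ℂ] L2 d), hn.1, one_mul, sub_self, sub_zero]
    rw [this]
    exact ((norm_mul_le _ _).trans (mul_le_of_le_one_left (norm_nonneg _) hP)).trans_lt hd'

/-- The dual of `bounded_below_of_mul_eq`, for an orthogonal projection `P = proj E`. -/
theorem bounded_below_star_of_mul_eq {Q T k : L2 d →L[ℂ] L2 d} {E : Set (Eu d)}
    (hE : MeasurableSet E) (h : T * Q = 1 + k) (hk : ‖(1 - proj E hE) * k‖ ≤ 1 / 2) :
    ∃ c > 0, ∀ x, c * ‖x‖ ≤ ‖star T x‖ + ‖proj E hE x‖ := by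
  refine bounded_below_of_mul_eq (Q := star Q) (k := star k) ?_ ?_
  · rw [← star_mul, h, star_add, star_one]
  · rw [← norm_star, star_mul, star_star, star_sub, star_one, star_proj]
    exact hk

/-- A ball about the origin lies in `S(n)` for large `n`, provided that `S` has a point. -/
theorem proj_ball_mem_idealOf {S : Set (Eu d)} (hS : S.Nonempty) (r : ℝ) :
    (⟨proj (ball 0 r) measurableSet_ball, proj_mem_stdAlgebra _⟩ : stdAlgebra d) ∈ idealOf S := by
  obtain ⟨s, hs⟩ := hS
  refine mem_idealOf_of_nbhdProj_mul (n := ⌈r + ‖s‖⌉₊) ?_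
  change proj _ _ * proj _ _ = proj _ _
  rw [proj_mul]
  congr 1
  refine inter_eq_right.2 fun x hx => mem_thickening_iff.2 ⟨s, hs, ?_⟩
  rw [mem_ball_zero_iff] at hx
  rw [dist_eq_norm]
  linarith [norm_sub_le x s, Nat.le_ceil (r + ‖s‖)]

/-- Invertibility modulo the compact operators implies invertibility modulo `𝒥_S`. -/
theorem isUnit_mk_idealOf_of_compactIdeal {S : Set (Eu d)} (hS : S.Nonempty) {T : stdAlgebra d}
    (h : IsUnit (Ideal.Quotient.mk (compactIdeal (L2 d)) (T : L2 d →L[ℂ] L2 d))) :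
    IsUnit (Ideal.Quotient.mk (idealOf S) T) := by
  obtain ⟨⟨q, hq⟩, ⟨q', hq'⟩⟩ := (isUnit_mk_iff _).1 h
  have hm : ∀ n : ℕ, MeasurableSet (ball (0 : Eu d) n)ᶜ := fun n => measurableSet_ball.compl
  have hlim : ∀ φ : L2 d, Tendsto (fun n => proj _ (hm n) φ) atTop (𝓝 0) :=
    tendsto_proj hm fun x => by
      filter_upwards [eventually_gt_atTop ⌈‖x‖⌉₊] with n hn
      rw [notMem_compl_iff, mem_ball_zero_iff]
      exact (Nat.le_ceil _).trans_lt (by exact_mod_cast hn)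
  -- Both compact errors become small off one common large ball.
  have h1 := (tendsto_compact_mul (fun n => norm_proj_le _ (hm n)) (fun n => star_proj _ (hm n))
    hlim hq).norm
  have h2 := (tendsto_mul_compact (fun n => norm_proj_le _ (hm n)) hlim hq').norm
  rw [norm_zero] at h1 h2
  obtain ⟨n, hn1, hn2⟩ := ((h1.eventually_le_const (show (0 : ℝ) < 1 / 2 by norm_num)).and
    (h2.eventually_le_const (show (0 : ℝ) < 1 / 2 by norm_num))).exists
  rw [← one_sub_proj _ measurableSet_ball] at hn1 hn2
  obtain ⟨c, hc, hcT⟩ := bounded_below_of_mul_eq (add_sub_cancel 1 _).symm hn1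
  obtain ⟨c', hc', hcT'⟩ := bounded_below_star_of_mul_eq measurableSet_ball
    (add_sub_cancel 1 _).symm hn2
  set P : stdAlgebra d := ⟨proj (ball 0 n) measurableSet_ball, proj_mem_stdAlgebra _⟩ with hP
  have hPI : P ∈ idealOf S := proj_ball_mem_idealOf hS n
  have u1 := isUnit_star_mul_self_add _ _ hc hcT
  have u2 := isUnit_star_mul_self_add _ _ hc' hcT'
  rw [star_star] at u2
  -- The parametrices `q`, `q'` need not lie in `𝒜`. These inverses do, by spectral permanence, so
  -- they can be used in `𝒜 / 𝒥_S`.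
  have w1 : IsUnit (star T * T + star P * P) := (stdAlgebra d).coe_isUnit.1 u1
  have w2 : IsUnit (T * star T + star P * P) := (stdAlgebra d).coe_isUnit.1 u2
  have hPP : star P * P ∈ idealOf S := (idealOf S).mul_mem_left _ hPI
  exact isUnit_mk_of_isUnit_add _ hPP hPP w1 w2

theorem specAt_subset_essSpec {S : Set (Eu d)} (hS : S.Nonempty) {A : L2 d →ₗ.[ℂ] L2 d} {α : ℂ}
    (hα : α ∈ resolventSet A) (hA : resolvent A α ∈ stdAlgebra d) : specAt S A ⊆ essSpec A := by
  rw [specAt_eq hα hA, essSpec_eq hα]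
  exact fun z hz hz' => hz (isUnit_mk_idealOf_of_compactIdeal hS hz')

/-! ### Translation invariance -/

theorem translate_add (v w : Eu d) : translate (v + w) = translate v * translate w := by
  ext1 φ
  apply Lp.ext
  rw [mul_apply_eq_comp]
  filter_upwards [translate_coeFn (v + w) φ, translate_coeFn v (translate w φ),
    (measurePreserving_add_right volume v).quasiMeasurePreserving.ae_eq_comp
      (translate_coeFn w φ)] with x h1 h2 h3
  simp only [Function.comp_apply] at h3
  rw [h1, h2, h3, add_assoc]

theorem translate_zero : translate (0 : Eu d) = 1 := by
  ext1 φ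
  apply Lp.ext
  filter_upwards [translate_coeFn 0 φ] with x h1
  rw [h1, add_zero]
  rfl

theorem star_translate (v : Eu d) : star (translate v) = translate (-v) := by
  rw [ContinuousLinearMap.star_eq_adjoint, eq_comm, ContinuousLinearMap.eq_adjoint_iff]
  intro φ ψ
  have h : ψ = translate (-v) (translate v ψ) := by
    rw [← mul_apply_eq_comp, ← translate_add, neg_add_cancel, translate_zero]
    rfl
  conv_lhs => rw [h]
  exact LinearIsometry.inner_map_map _ _ _

theorem commute_translate_nsmul {v : Eu d} {T : L2 d →L[ℂ] L2 d} (h : Commute (translate v) T)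
    (n : ℕ) : Commute (translate (n • v)) T := by
  induction n with
  | zero =>
    rw [zero_smul, translate_zero]
    exact Commute.one_left _
  | succ n ih =>
    rw [succ_nsmul, translate_add]
    exact ih.mul_left h

/-- Translation is isometric and intertwines `P_E` with the projection onto `E + v`. -/
theorem norm_proj_translate {E : Set (Eu d)} (hE : MeasurableSet E) (v : Eu d) (φ : L2 d) :
    ‖proj E hE (translate v φ)‖ =
      ‖proj ((fun x => x - v) ⁻¹' E) (measurable_sub_const v hE) φ‖ := by
  rw [← norm_translate v (proj _ _ φ)]
  congr 1
  apply Lp.ext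
  filter_upwards [proj_coeFn E hE (translate v φ), translate_coeFn v φ,
    translate_coeFn v (proj ((fun x => x - v) ⁻¹' E) (measurable_sub_const v hE) φ),
    (measurePreserving_add_right volume v).quasiMeasurePreserving.ae_eq_comp
      (proj_coeFn ((fun x => x - v) ⁻¹' E) (measurable_sub_const v hE) φ)] with x h1 h2 h3 h4
  simp only [Function.comp_apply] at h4
  rw [h1, h3, h4]
  by_cases hx : x ∈ E <;> simp [hx, h2]

/-- An operator that is bounded below up to `P_E` and commutes with translations moving `E` to
infinity is bounded below. -/
theorem bounded_below_of_commute {T : L2 d →L[ℂ] L2 d} {E : Set (Eu d)} (hE : MeasurableSet E)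
    {c : ℝ} (h : ∀ x, c * ‖x‖ ≤ ‖T x‖ + ‖proj E hE x‖) {w : ℕ → Eu d}
    (hw : ∀ n, Commute (translate (w n)) T) (hwE : ∀ x, ∀ᶠ n in atTop, x - w n ∉ E) (φ : L2 d) :
    c * ‖φ‖ ≤ ‖T φ‖ := by
  -- The estimate is applied to the translates of `φ`: the norms of `φ` and `T φ` do not change,
  -- while the `P_E` term tends to zero.
  have hlim := (tendsto_proj (fun n => measurable_sub_const (w n) hE) hwE φ).norm.const_add ‖T φ‖
  rw [norm_zero, add_zero] at hlim
  refine ge_of_tendsto' hlim fun n => ?_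
  have := h (translate (w n) φ)
  rwa [norm_proj_translate, norm_translate, ← mul_apply_eq_comp, ← (hw n).eq, mul_apply_eq_comp,
    norm_translate] at this

/-- An operator in `𝒜` commuting with a translation that moves every neighbourhood of `S` to
infinity is invertible as soon as it is invertible modulo `𝒥_S`. -/
theorem isUnit_of_isUnit_mk_idealOf {S : Set (Eu d)} {T : stdAlgebra d}
    (h : IsUnit (Ideal.Quotient.mk (idealOf S) T)) {v : Eu d}
    (hv : Commute (translate v) (T : L2 d →L[ℂ] L2 d))
    (hvS : ∀ (r : ℝ) (x : Eu d), ∀ᶠ n : ℕ in atTop, x - n • v ∉ thickening r S)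
    (hvS' : ∀ (r : ℝ) (x : Eu d), ∀ᶠ n : ℕ in atTop, x - n • (-v) ∉ thickening r S) :
    IsUnit (T : L2 d →L[ℂ] L2 d) := by
  obtain ⟨⟨q, hq⟩, ⟨q', hq'⟩⟩ := (isUnit_mk_iff _).1 h
  obtain ⟨n, hn, -⟩ := exists_nbhdProj_of_mem_idealOf hq
  obtain ⟨n', -, hn'⟩ := exists_nbhdProj_of_mem_idealOf hq'
  obtain ⟨c, hc, hcT⟩ := bounded_below_of_mul_eq (Q := (q : L2 d →L[ℂ] L2 d))
    (T := (T : L2 d →L[ℂ] L2 d)) (add_sub_cancel 1 _).symm (hn.le.trans (by norm_num))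
  obtain ⟨c', hc', hcT'⟩ := bounded_below_star_of_mul_eq (Q := (q' : L2 d →L[ℂ] L2 d))
    (T := (T : L2 d →L[ℂ] L2 d)) isOpen_thickening.measurableSet
    (add_sub_cancel 1 _).symm (hn'.le.trans (by norm_num))
  -- Taking adjoints reverses the translation, which is why both directions of escape are assumed.
  have hv' : Commute (translate (-v)) (star (T : L2 d →L[ℂ] L2 d)) := by
    rw [← star_translate]
    exact hv.star_star
  exact isUnit_of_bounded_below hc hc'
    (bounded_below_of_commute isOpen_thickening.measurableSet hcT
      (fun n => commute_translate_nsmul hv n) (hvS _))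
    (bounded_below_of_commute isOpen_thickening.measurableSet hcT'
      (fun n => commute_translate_nsmul hv' n) (hvS' _))

theorem relMul_commute_translate {A : L2 d →L[ℂ] L2 d} {V : Eu d → ℂ}
    (hm : AEStronglyMeasurable V volume) (hb : relNorm A V < ∞) {v : Eu d}
    (hA : Commute (translate v) A) (hV : ∀ᵐ x : Eu d, V (x + v) = V x) :
    Commute (translate v) (relMul A V hm hb) := by
  ext1 φ
  apply Lp.ext
  rw [mul_apply_eq_comp, mul_apply_eq_comp]
  have e : A (translate v φ) = translate v (A φ) := by
    rw [← mul_apply_eq_comp, ← hA.eq, mul_apply_eq_comp]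
  filter_upwards [translate_coeFn v (relMul A V hm hb φ),
    relMul_coeFn A V hm hb (translate v φ), translate_coeFn v (A φ), hV,
    (measurePreserving_add_right volume v).quasiMeasurePreserving.ae_eq_comp
      (relMul_coeFn A V hm hb φ)] with x h1 h2 h3 h4 h5
  simp only [Function.comp_apply] at h5
  rw [h1, h2, h5, e, h3, h4]

theorem abs_lt_of_mem_thickening_slab [NeZero d] {r : ℝ} {x : Eu d}
    (hx : x ∈ thickening r {x : Eu d | |x 0| < 1}) : |x 0| < r + 1 := by
  obtain ⟨y, hy, hxy⟩ := mem_thickening_iff.1 hx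
  have h1 : |x 0 - y 0| ≤ dist x y := by
    rw [dist_eq_norm]
    exact PiLp.norm_apply_le (x - y) 0
  have h2 : |y 0| < 1 := hy
  have h3 := abs_sub_abs_le_abs_sub (x 0) (y 0)
  linarith

theorem eventually_sub_nsmul_notMem_thickening_slab [NeZero d] {v : Eu d} (hv : v 0 ≠ 0) (r : ℝ)
    (x : Eu d) : ∀ᶠ n : ℕ in atTop, x - n • v ∉ thickening r {x : Eu d | |x 0| < 1} := by
  have hlim : Tendsto (fun n : ℕ => (n : ℝ) * |v 0|) atTop atTop :=
    tendsto_natCast_atTop_atTop.atTop_mul_const (abs_pos.2 hv)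
  filter_upwards [hlim.eventually_ge_atTop (r + 1 + |x 0|)] with n hn hmem
  have h1 := abs_lt_of_mem_thickening_slab hmem
  have h2 : (x - n • v) 0 = x 0 - n * v 0 := by simp
  -- The first coordinate of the shifted point has modulus at least `n|v₀| - |x₀| ≥ r + 1`, outside
  -- the thickened slab.
  have h3 := abs_sub_abs_le_abs_sub ((n : ℝ) * v 0) (x 0)
  rw [abs_mul, Nat.abs_cast, abs_sub_comm] at h3
  rw [h2] at h1
  linarith

/-! ### Schrödinger operators with a potential of relative norm less than one -/

section Schrodinger

variable {a : ℝ} {V W : Eu d → ℂ}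

theorem exists_resolvent_schrodinger (ha : 0 < a) (hV : V ∈ potentials (freeResolvent d a))
    (hV1 : relNorm (freeResolvent d a) V < 1) :
    ∃ u : (L2 d →L[ℂ] L2 d)ˣ, u.val = 1 + relMul (freeResolvent d a) V hV.1 hV.2.1 ∧
      u⁻¹.val ∈ stdAlgebra d ∧
      IsResolventAt (schrodinger V) (-(a : ℂ)) (-(freeResolvent d a * u⁻¹.val)) := by
  obtain ⟨u, hu⟩ := isUnit_one_add_relMul hV.1 hV.2.1 hV1
  refine ⟨u, hu, inv_mem_stdAlgebra ?_,
    isResolventAt_schrodinger (isResolventAt_freeResolvent ha) hV.1 hV.2.1 hu⟩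
  rw [hu]
  exact add_mem (one_mem _) (relMul_mem_stdAlgebra (freeResolvent_mem_stdAlgebra ha) hV)

theorem mem_resolventSet_schrodinger (ha : 0 < a) (hV : V ∈ potentials (freeResolvent d a))
    (hV1 : relNorm (freeResolvent d a) V < 1) : -(a : ℂ) ∈ resolventSet (schrodinger V) := by
  obtain ⟨u, -, -, h⟩ := exists_resolvent_schrodinger ha hV hV1
  exact h.mem

theorem resolvent_schrodinger_mem_stdAlgebra (ha : 0 < a)
    (hV : V ∈ potentials (freeResolvent d a)) (hV1 : relNorm (freeResolvent d a) V < 1) :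
    resolvent (schrodinger V) (-(a : ℂ)) ∈ stdAlgebra d := by
  obtain ⟨u, -, hu, h⟩ := exists_resolvent_schrodinger ha hV hV1
  rw [h.resolvent_eq]
  exact neg_mem (mul_mem (freeResolvent_mem_stdAlgebra ha) hu)

theorem affiliated_schrodinger (ha : 0 < a) (hV : V ∈ potentials (freeResolvent d a))
    (hV1 : relNorm (freeResolvent d a) V < 1) : Affiliated (schrodinger V) :=
  ⟨isClosed_of_mem_resolventSet (mem_resolventSet_schrodinger ha hV hV1), _,
    mem_resolventSet_schrodinger ha hV hV1, resolvent_schrodinger_mem_stdAlgebra ha hV hV1⟩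

theorem translate_resolvent_schrodinger (ha : 0 < a) (hV : V ∈ potentials (freeResolvent d a))
    (hV1 : relNorm (freeResolvent d a) V < 1) {v : Eu d} (hv : ∀ᵐ x : Eu d, V (x + v) = V x) :
    Commute (translate v) (resolvent (schrodinger V) (-(a : ℂ))) := by
  obtain ⟨u, hu, -, h⟩ := exists_resolvent_schrodinger ha hV hV1
  rw [h.resolvent_eq]
  have h0 := translate_freeResolvent (d := d) ha v
  have h1 : Commute (translate v) u.val := by
    rw [hu]
    exact (Commute.one_right _).add_right (relMul_commute_translate hV.1 hV.2.1 h0 hv)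
  exact (h0.mul_right h1.units_inv_right).neg_right

/-- The resolvents of two Schrödinger operators whose potentials differ only near `S` differ by an
element of `𝒥_S`. -/
theorem resolvent_schrodinger_sub_mem_idealOf (ha : 0 < a)
    (hV : V ∈ potentials (freeResolvent d a)) (hV1 : relNorm (freeResolvent d a) V < 1)
    (hW : W ∈ potentials (freeResolvent d a)) (hW1 : relNorm (freeResolvent d a) W < 1)
    {S : Set (Eu d)} {c : ℝ} (hVW : ∀ᵐ x : Eu d, x ∉ thickening c S → V x = W x) :
    (⟨_, resolvent_schrodinger_mem_stdAlgebra ha hV hV1⟩ : stdAlgebra d) -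
      ⟨_, resolvent_schrodinger_mem_stdAlgebra ha hW hW1⟩ ∈ idealOf S := by
  obtain ⟨u, hu, hu', hRV⟩ := exists_resolvent_schrodinger ha hV hV1
  obtain ⟨w, hw, hw', hRW⟩ := exists_resolvent_schrodinger ha hW hW1
  set R := freeResolvent d a
  set KV := relMul R V hV.1 hV.2.1
  set KW := relMul R W hW.1 hW.2.1
  have hR : R ∈ stdAlgebra d := freeResolvent_mem_stdAlgebra ha
  have hK : KV - KW ∈ stdAlgebra d :=
    sub_mem (relMul_mem_stdAlgebra hR hV) (relMul_mem_stdAlgebra hR hW)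
  -- `KV - KW` is `(V - W) R₀`, whose range lives where `V ≠ W`, so confinement on the left is
  -- immediate.
  have hKI : (⟨KV - KW, hK⟩ : stdAlgebra d) ∈ idealOf S := by
    refine mem_idealOf_of_nbhdProj_mul (n := ⌈c⌉₊) ?_
    ext1 φ
    apply Lp.ext
    rw [mul_apply_eq_comp]
    change (proj _ _ ((KV - KW) φ) : Eu d → ℂ) =ᵐ[volume] ((KV - KW) φ : L2 d)
    have hsub : (((KV - KW) φ : L2 d) : Eu d → ℂ) =ᵐ[volume] KV φ - KW φ := Lp.coeFn_sub _ _
    filter_upwards [proj_coeFn (thickening (⌈c⌉₊ : ℝ) S) isOpen_thickening.measurableSet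
      ((KV - KW) φ), hsub, relMul_coeFn R V hV.1 hV.2.1 φ, relMul_coeFn R W hW.1 hW.2.1 φ, hVW]
      with x h1 h2 h3 h4 h5
    rw [h1]
    by_cases hx : x ∈ thickening (⌈c⌉₊ : ℝ) S
    · rw [indicator_of_mem hx]
    · rw [indicator_of_notMem hx, h2, Pi.sub_apply, h3, h4,
        h5 fun h => hx (thickening_mono (Nat.le_ceil c) S h), sub_self]
  -- Second resolvent identity: `R w⁻¹ - R u⁻¹ = R u⁻¹ (u - w) w⁻¹`.
  have e : (⟨_, resolvent_schrodinger_mem_stdAlgebra ha hV hV1⟩ : stdAlgebra d) -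
      ⟨_, resolvent_schrodinger_mem_stdAlgebra ha hW hW1⟩ =
      ⟨R * u⁻¹.val, mul_mem hR hu'⟩ * ⟨KV - KW, hK⟩ * ⟨w⁻¹.val, hw'⟩ := by
    apply Subtype.ext
    change resolvent (schrodinger V) _ - resolvent (schrodinger W) _ =
      R * u⁻¹.val * (KV - KW) * w⁻¹.val
    rw [hRV.resolvent_eq, hRW.resolvent_eq]
    have : KV - KW = u.val - w.val := by rw [hu, hw, add_sub_add_left_eq_sub]
    rw [this, mul_sub, sub_mul, mul_assoc R, u.inv_mul, mul_assoc _ w.val, w.mul_inv]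
    noncomm_ring
  rw [e]
  exact (idealOf S).mul_mem_right _ ((idealOf S).mul_mem_left _ hKI)

theorem specAt_schrodinger_eq (ha : 0 < a)
    (hV : V ∈ potentials (freeResolvent d a)) (hV1 : relNorm (freeResolvent d a) V < 1)
    (hW : W ∈ potentials (freeResolvent d a)) (hW1 : relNorm (freeResolvent d a) W < 1)
    {S : Set (Eu d)} {c : ℝ} (hVW : ∀ᵐ x : Eu d, x ∉ thickening c S → V x = W x) :
    specAt S (schrodinger V) = specAt S (schrodinger W) := by
  rw [specAt_eq (mem_resolventSet_schrodinger ha hV hV1)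
    (resolvent_schrodinger_mem_stdAlgebra ha hV hV1),
    specAt_eq (mem_resolventSet_schrodinger ha hW hW1)
    (resolvent_schrodinger_mem_stdAlgebra ha hW hW1)]
  ext z
  rw [mem_ofPred_eq, mem_ofPred_eq]
  rw [mk_one_add_smul_eq (idealOf S)
    (resolvent_schrodinger_sub_mem_idealOf ha hV hV1 hW hW1 hVW) (z - -(a : ℂ))]

theorem spec_schrodinger_subset_specAt (ha : 0 < a) (hW : W ∈ potentials (freeResolvent d a))
    (hW1 : relNorm (freeResolvent d a) W < 1) {S : Set (Eu d)} {v : Eu d}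
    (hv : ∀ᵐ x : Eu d, W (x + v) = W x)
    (hvS : ∀ (r : ℝ) (x : Eu d), ∀ᶠ n : ℕ in atTop, x - n • v ∉ thickening r S)
    (hvS' : ∀ (r : ℝ) (x : Eu d), ∀ᶠ n : ℕ in atTop, x - n • (-v) ∉ thickening r S) :
    spec (schrodinger W) ⊆ specAt S (schrodinger W) := by
  have hα := mem_resolventSet_schrodinger ha hW hW1
  rw [specAt_eq hα (resolvent_schrodinger_mem_stdAlgebra ha hW hW1)]
  intro z hz h
  refine hz (mem_resolventSet_of_isUnit hα (isUnit_of_isUnit_mk_idealOf h (v := v) ?_ hvS hvS'))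
  exact (Commute.one_right _).add_right
    ((translate_resolvent_schrodinger ha hW hW1 hv).smul_right _)

end Schrodinger

end DaviesSpectra

/-! ### The theorem for the slab. -/

theorem mainTheorem9 (d : ℕ) [NeZero d] (a : ℝ) (ha : 0 < a)
    (W X : DaviesSpectra.Eu d → ℂ)
    (hV : W + X ∈ DaviesSpectra.potentials (DaviesSpectra.freeResolvent d a))
    (hW : W ∈ DaviesSpectra.potentials (DaviesSpectra.freeResolvent d a))
    (hV1 : DaviesSpectra.relNorm (DaviesSpectra.freeResolvent d a) (W + X) < 1)
    (hW1 : DaviesSpectra.relNorm (DaviesSpectra.freeResolvent d a) W < 1)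
    (k : ℝ) (hk : 0 < k)
    (hper : ∀ᵐ x : DaviesSpectra.Eu d, W (x + EuclideanSpace.single 0 k) = W x)
    (S : Set (DaviesSpectra.Eu d)) (hS : S = {x | |x 0| < 1})
    (c : ℝ) (hc : 1 ≤ c)
    (hX : ∀ᵐ x : DaviesSpectra.Eu d, x ∉ Metric.thickening c S → X x = 0) :
    DaviesSpectra.Affiliated (DaviesSpectra.schrodinger W) ∧
    DaviesSpectra.Affiliated (DaviesSpectra.schrodinger (W + X)) ∧
    DaviesSpectra.spec (DaviesSpectra.schrodinger W) =
      DaviesSpectra.essSpec (DaviesSpectra.schrodinger W) ∧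
    DaviesSpectra.essSpec (DaviesSpectra.schrodinger W) =
      DaviesSpectra.specAt S (DaviesSpectra.schrodinger W) ∧
    DaviesSpectra.specAt S (DaviesSpectra.schrodinger W) =
      DaviesSpectra.specAt S (DaviesSpectra.schrodinger (W + X)) ∧
    DaviesSpectra.specAt S (DaviesSpectra.schrodinger (W + X)) ⊆
      DaviesSpectra.essSpec (DaviesSpectra.schrodinger (W + X)) ∧
    DaviesSpectra.essSpec (DaviesSpectra.schrodinger (W + X)) ⊆
      DaviesSpectra.spec (DaviesSpectra.schrodinger (W + X)) := by
  subst hS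
  have hne : {x : DaviesSpectra.Eu d | |x 0| < 1}.Nonempty := ⟨0, by simp⟩
  have hWX : ∀ᵐ x : DaviesSpectra.Eu d,
      x ∉ Metric.thickening c {x : DaviesSpectra.Eu d | |x 0| < 1} → W x = (W + X) x := by
    filter_upwards [hX] with x hx h
    rw [Pi.add_apply, hx h, add_zero]
  -- For `W` the inclusions `spec ⊆ specAt ⊆ essSpec ⊆ spec` form a cycle, so all three sets are
  -- equal. Only the first of them needs periodicity; the other two are reused for `W + X`.
  have h1 := DaviesSpectra.essSpec_subset_spec (DaviesSpectra.schrodinger W)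
  have h2 := DaviesSpectra.specAt_subset_essSpec hne
    (DaviesSpectra.mem_resolventSet_schrodinger ha hW hW1)
    (DaviesSpectra.resolvent_schrodinger_mem_stdAlgebra ha hW hW1)
  have h3 := DaviesSpectra.spec_schrodinger_subset_specAt ha hW hW1 hper
    (DaviesSpectra.eventually_sub_nsmul_notMem_thickening_slab (by simpa using hk.ne'))
    (DaviesSpectra.eventually_sub_nsmul_notMem_thickening_slab (by simpa using hk.ne'))
  exact ⟨DaviesSpectra.affiliated_schrodinger ha hW hW1,
    DaviesSpectra.affiliated_schrodinger ha hV hV1,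
    (h3.trans h2).antisymm h1, (h1.trans h3).antisymm h2,
    DaviesSpectra.specAt_schrodinger_eq ha hW hW1 hV hV1 hWX,
    DaviesSpectra.specAt_subset_essSpec hne
      (DaviesSpectra.mem_resolventSet_schrodinger ha hV hV1)
      (DaviesSpectra.resolvent_schrodinger_mem_stdAlgebra ha hV hV1),
    DaviesSpectra.essSpec_subset_spec _⟩
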